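/- Let $\mathcal X,\mathcal U$ be finite non-empty sets and $\Delta(\cdot)$ the set of probability distributions on a finite set. Let $M_i=(\mathcal X,\mathcal U,P_i,r_i)$, $i=0,1$, be two Markov decision processes with transition probabilities $P_i(\cdot|x,u)\in\Delta(\mathcal X)$ that are ergodic: for every policy $\pi:\mathcal X\to\Delta(\mathcal U)$ the chain with transition probabilities $P_i^{\pi}(x'|x)=\sum_u\pi(u|x)P_i(x'|x,u)$ is irreducible (hence positive recurrent, with a unique stationary distribution $\mu_i^\pi$). Assume $P_1(x,u)\ll P_0(x,u)$ for all $(x,u)$. Fix policies $\pi_0,\pi_1$, and any $\xi\in\Delta(\mathcal X)$ (for instance $\xi=\mu_1^{\pi_1}$). For conditional densities $f_0,f_1$ of a sequence $Y_1,Y_2,\dots$ given its past, let $\mathbb P_\nu$ ($\nu\ge1$) be the law under which $Y_t$ has conditional density $f_0(\cdot|Y_1,\dots,Y_{t-1})$ for $t<\nu$ and $f_1(\cdot|Y_1,\dots,Y_{t-1})$ for $t\ge\nu$, let $\mathcal F_t=\sigma(Y_1,\dots,Y_t)$, and let $Z_i=\ln\frac{f_1(Y_i|Y_1,\dots,Y_{i-1})}{f_0(Y_i|Y_1,\dots,Y_{i-1})}\in[-\infty,\infty]$.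 Assumption 1 holds with the constant $I\in\mathbb R$ if, for every $\nu\ge 1$, $n^{-1}\sum_{t=\nu}^{\nu+n}Z_t\to I$ almost surely under $\mathbb P_\nu$ as $n\to\infty$ and, for all $\delta>0$, $$\lim_{n\to\infty}\ \sup_{\nu\ge1}\ \operatorname{ess\,sup}\ \mathbb P_\nu\Big(\max_{t\le n}\sum_{i=\nu}^{\nu+t}Z_i\ge I(1+\delta)n\,\Big|\,\mathcal F_{\nu-1}\Big)=0 .$$ The inverse privacy level of the observations is this $I$ if Assumption 1 holds with some $I$, and $\infty$ otherwise. Let $I_L$ be the inverse privacy level for $Y_t=X_t$, that is, for $f_i(x'|x)=P_i^{\pi_i}(x'|x)$, and $I_F$ that for $Y_t=(X_t,U_t)$, that is, for $f_i(x',u'|x,u)=P_i(x'|x,u)\,\pi_i(u'|x')$. Here the first state $X_1$ has law $\mu_0^{\pi_0}$ under $f_0$ and $\xi$ under $f_1$; in the second case $U_1\sim\pi_i(X_1)$ under $f_i$. Let $D$ denote the Kullback–Leibler divergence and $d(p,q)=p\ln\frac pq+(1-p)\ln\frac{1-p}{1-q}$. (i) If $P_1^{\pi_1}(x)\ll P_0^{\pi_0}(x)$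 for all $x\in\operatorname{supp}(\mu_1^{\pi_1})$, and $P_1^{\pi_1}\ne P_0^{\pi_0}$, then the observations $Y_t=X_t$ satisfy Assumption 1, $$I_L=\mathbb E_{x\sim\mu_1^{\pi_1}}\big[D\big(P_1^{\pi_1}(x),P_0^{\pi_0}(x)\big)\big],\qquad I_L\le I_F,$$ and $$\mathbb E_{x\sim\mu_1^{\pi_1}}\Big[\sup_{x'\in\mathcal X}d\big(P_1^{\pi_1}(x'|x),P_0^{\pi_0}(x'|x)\big)\Big]\le I_L .$$ (ii) If $P_1^{\pi_1}(x)\not\ll P_0^{\pi_0}(x)$ for some $x\in\operatorname{supp}(\mu_1^{\pi_1})$, then $I_L=\infty$. -/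

import Mathlib

open MeasureTheory ProbabilityTheory Filter Topology
open scoped ENNReal

noncomputable section

namespace PrivacyMDP

/-! ### Quickest change detection on a discrete observation space

Observations are indexed by `ℕ`: the first observation is the coordinate `0`, and the change time
`ν : ℕ` is the index of the first observation that is produced by the post-change model (so `ν = 0`
means that all observations are post-change ones). -/

/-- A sequential model on a discrete space `S`: the density of the first observation and, for each
`n`, the conditional density of observation `n + 1` given the observations `0, …, n`. Densities are
with respect to the counting measure. -/
structure SeqModel (S : Type*) where
  /-- density of the first observation -/
  init : PMF S
  /-- conditional density of observation `n + 1` given the observations `0, …, n` -/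
  next : (n : ℕ) → ((Finset.Iic n) → S) → PMF S

/-- The value `f(Y_n | Y_0, …, Y_{n-1})` of the conditional density along the trajectory `y`. -/
def SeqModel.density {S : Type*} (f : SeqModel S) (y : ℕ → S) : ℕ → ℝ≥0∞
  | 0 => f.init (y 0)
  | n + 1 => f.next n (fun i => y i) (y (n + 1))

section Change

variable {S : Type*} [Fintype S] [MeasurableSpace S] [MeasurableSingletonClass S]

/-- Transition kernel to observation `n + 1`, given the past, when the change time is `ν`. -/
def changeKernel (f₀ f₁ : SeqModel S) (ν n : ℕ) : Kernel ((Finset.Iic n) → S) S :=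
  Kernel.ofFunOfCountable
    (fun h => if n + 1 < ν then (f₀.next n h).toMeasure else (f₁.next n h).toMeasure)

instance (f₀ f₁ : SeqModel S) (ν n : ℕ) : IsMarkovKernel (changeKernel f₀ f₁ ν n) := by
  refine ⟨fun h => ?_⟩
  change IsProbabilityMeasure
    (if n + 1 < ν then (f₀.next n h).toMeasure else (f₁.next n h).toMeasure)
  split_ifs <;> infer_instance

/-- The law of the first observation when the change time is `ν`. -/
def changeInit (f₀ f₁ : SeqModel S) (ν : ℕ) : PMF S := if 0 < ν then f₀.init else f₁.init

/-- The law `ℙ_ν` of the observations when the change time is `ν`: the conditional density of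
observation `t` given the past is `f₀` for `t < ν` and `f₁` for `t ≥ ν`. -/
def changeLaw (f₀ f₁ : SeqModel S) (ν : ℕ) : Measure (ℕ → S) :=
  Kernel.trajMeasure (X := fun _ => S) (changeInit f₀ f₁ ν).toMeasure (changeKernel f₀ f₁ ν)

/-- The log-likelihood ratio `Z_t = ln (f₁(Y_t | past) / f₀(Y_t | past))`, with values in `[-∞, ∞]`;
it is `+∞` when `f₁ > 0 = f₀`. -/
def llRatio (f₀ f₁ : SeqModel S) (t : ℕ) (y : ℕ → S) : EReal :=
  ENNReal.log (f₁.density y t / f₀.density y t)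

/-- `∑_{i = ν}^{ν + t} Z_i`. -/
def llSum (f₀ f₁ : SeqModel S) (ν t : ℕ) (y : ℕ → S) : EReal :=
  ∑ i ∈ Finset.Icc ν (ν + t), llRatio f₀ f₁ i y

/-- The σ-algebra generated by the observations strictly before time `ν`. -/
abbrev pastSigma (S : Type*) [MeasurableSpace S] (ν : ℕ) : MeasurableSpace (ℕ → S) :=
  MeasurableSpace.comap (fun (y : ℕ → S) (i : Fin ν) => y i) inferInstance

/-- The event `max_{t ≤ n} ∑_{i = ν}^{ν + t} Z_i ≥ I (1 + δ) n`. -/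
def exceedEvent (f₀ f₁ : SeqModel S) (I δ : ℝ) (ν n : ℕ) : Set (ℕ → S) :=
  {y | ((I * (1 + δ) * n : ℝ) : EReal) ≤
    (Finset.range (n + 1)).sup (fun t => llSum f₀ f₁ ν t y)}

/-- Convergence assumption on the log-likelihood ratios, with constant `I`: for every change time
`ν`, `n⁻¹ ∑_{t = ν}^{ν + n} Z_t → I` almost surely under `ℙ_ν`, and for all `δ > 0`
`sup_ν ess sup ℙ_ν (max_{t ≤ n} ∑_{i = ν}^{ν + t} Z_i ≥ I (1 + δ) n | ℱ_{ν - 1}) → 0`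
as `n → ∞`. -/
structure ConvergenceAssumption (f₀ f₁ : SeqModel S) (I : ℝ) : Prop where
  tendsto_average : ∀ ν : ℕ, ∀ᵐ y ∂(changeLaw f₀ f₁ ν),
    Tendsto (fun n : ℕ => llSum f₀ f₁ ν n y / (n : EReal)) atTop (𝓝 (I : EReal))
  tendsto_exceed : ∀ δ : ℝ, 0 < δ →
    Tendsto (fun n : ℕ => ⨆ ν : ℕ, essSup (fun y => ENNReal.ofReal
        (((changeLaw f₀ f₁ ν)⟦exceedEvent f₀ f₁ I δ ν n | pastSigma S ν⟧) y))
        (changeLaw f₀ f₁ ν))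
      atTop (𝓝 (0 : ℝ≥0∞))

open scoped Classical in
/-- The inverse of the privacy level of the observations: the constant `I` of the convergence
assumption (it is unique, being an almost sure limit) if the assumption holds, and `∞` if not. -/
def infoRate (f₀ f₁ : SeqModel S) : EReal :=
  if h : ∃ I : ℝ, ConvergenceAssumption f₀ f₁ I then ((h.choose : ℝ) : EReal) else ⊤

end Change

/-! ### Markov decision processes -/

/-- A Markov decision process with state space `X` and action space `U`. -/
structure MDP (X U : Type*) where
  /-- transition probabilities `P(· | x, u)` -/
  P : X → U → PMF X
  /-- reward function -/
  r : X → U → ℝ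

/-- Randomized control policies. -/
abbrev Policy (X U : Type*) := X → PMF U

/-- The transition probabilities `P^π(x' | x) = ∑_u π(u | x) P(x' | x, u)` of the states. -/
def MDP.induced {X U : Type*} (M : MDP X U) (π : Policy X U) : X → PMF X :=
  fun x => (π x).bind (fun u => M.P x u)

/-- Irreducibility of a Markov chain on a discrete space: from every state every state is reached
along transitions of positive probability. -/
def IsIrreducibleChain {X : Type*} (K : X → PMF X) : Prop :=
  ∀ x y : X, Relation.ReflTransGen (fun a b => b ∈ (K a).support) x y

/-- `μ` is a stationary distribution of the chain `K`. -/
def IsStationary {X : Type*} (K : X → PMF X) (μ : PMF X) : Prop := μ.bind K = μ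

/-- A (finite) MDP is ergodic if every policy induces an irreducible chain. As the state space is
finite, this says that all states are positive recurrent and that the stationary distribution is
unique. -/
def MDP.IsErgodic {X U : Type*} (M : MDP X U) : Prop :=
  ∀ π : Policy X U, IsIrreducibleChain (M.induced π)

/-- Observation of the state only: `Y_t = X_t`, with first observation of law `μ`. -/
def MDP.limitedModel {X U : Type*} (M : MDP X U) (π : Policy X U) (μ : PMF X) : SeqModel X where
  init := μ
  next n h := M.induced π (h ⟨n, Finset.mem_Iic.2 le_rfl⟩)

/-- The law of `(X, A)` when `X ∼ μ` and `A ∼ π(· | X)`. -/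
def stateAction {X U : Type*} (μ : PMF X) (π : Policy X U) : PMF (X × U) :=
  μ.bind (fun x => (π x).map (fun u => (x, u)))

/-- Observation of the state and the action: `Y_t = (X_t, U_t)`, where the first state has law `μ`.
The conditional density is `f(y, a | x, u) = P(y | x, u) π(a | y)`. -/
def MDP.fullModel {X U : Type*} (M : MDP X U) (π : Policy X U) (μ : PMF X) :
    SeqModel (X × U) where
  init := stateAction μ π
  next n h := stateAction
    (M.P (h ⟨n, Finset.mem_Iic.2 le_rfl⟩).1 (h ⟨n, Finset.mem_Iic.2 le_rfl⟩).2) π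

/-! ### Divergences -/

/-- Kullback–Leibler divergence `D(P, Q)` of two distributions on a discrete space. -/
def D {X : Type*} [MeasurableSpace X] (P Q : PMF X) : ℝ≥0∞ :=
  InformationTheory.klDiv P.toMeasure Q.toMeasure

/-- Divergence `d(p, q) = p ln (p / q) + (1 - p) ln ((1 - p) / (1 - q))` of two Bernoulli
distributions, for `p, q ∈ [0, 1]`, with values in `[0, ∞]` (and `0 ln 0 = 0 ln (0 / 0) = 0`). -/
def d (p q : ℝ≥0∞) : EReal :=
  (p : EReal) * ENNReal.log (p / q) + ((1 - p : ℝ≥0∞) : EReal) * ENNReal.log ((1 - p) / (1 - q))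

end PrivacyMDP

end

/-!
Both observation models are homogeneous Markov chains on a finite set, so everything rests on a
strong law of large numbers with an exponential rate for functions `φ(Y_t, Y_{t+1})` of a
transition.

*Centring.* For an irreducible chain the harmonic functions are constant (maximum principle),
hence the Poisson equation `g - K g = f - μ(f)` is solvable (`IsLiouville.exists_poisson`). It
turns the sum of `φ(Y_t, Y_{t+1}) - μ(φ)` into a sum of bounded centred terms `ψ(Y_t, Y_{t+1})`
plus a bounded telescoping term (`IsLiouville.exists_centred`). The chain of state-action pairs
need not be irreducible (actions of probability zero), but its harmonic functions are constant as
well, which is all that is needed (`MDP.isLiouville_fullKernel`).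

*Exponential bounds.* For every event `A` of the past, `𝔼[1_A exp (l ∑_{i<n} ψ)] ≤ exp (l² B² n)
ℙ(A)` (`lintegral_exp_pairSum_le`). With `A` the sure event and the Borel–Cantelli lemma this
gives the almost sure convergence of the averages. With general `A` it bounds the conditional
probability given the past, uniformly in the change time, by a union bound over `t ≤ n`; this uses
that the limit `I` is positive (`IsLiouville.exists_exceed_bound`).

*Singular case.* If a transition of the post-change chain is impossible before the change, then it
occurs almost surely and the log-likelihood ratios have an infinite sum from then on, so that no
real limit exists (`IsLiouville.not_convergenceAssumption`).

*Comparisons.* The limit is the stationary mean of a Kullback–Leibler divergence. Applying the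
data processing inequality to the indicator of a state gives the lower bound by binary divergences
(`d_le_D`); applying it to the projection from (action, next state) to the next state, and using
stationarity to move the divergence of the policies by one step, gives the comparison of limited
and full observation (`infoRate_limited_le_full`).
-/

open MeasureTheory ProbabilityTheory Filter Topology
open scoped ENNReal

noncomputable section

namespace PrivacyMDP

/-! ### Finite Markov chains: harmonic functions and the Poisson equation -/

section Chain

variable {S T : Type*}

lemma toReal_pos_of_mem_support {p : PMF S} {y : S} (h : y ∈ p.support) : 0 < (p y).toReal :=
  ENNReal.toReal_pos ((p.mem_support_iff y).1 h) (p.apply_ne_top y)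

lemma IsStationary.mem_support_of_step {K : S → PMF S} {μ : PMF S} (hμ : IsStationary K μ) {x y : S}
    (hx : x ∈ μ.support) (hy : y ∈ (K x).support) : y ∈ μ.support := by
  rw [← hμ, PMF.mem_support_bind_iff]
  exact ⟨x, hx, hy⟩

lemma IsStationary.mem_support {K : S → PMF S} {μ : PMF S} (hμ : IsStationary K μ)
    (hK : IsIrreducibleChain K) (x : S) : x ∈ μ.support := by
  obtain ⟨z, hz⟩ := μ.support_nonempty
  induction hK z x with
  | refl => exact hz
  | tail _ hbc ih => exact hμ.mem_support_of_step ih hbc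

variable [Fintype S] [Fintype T]

/-- The expectation `∑ y, p y * f y` of a real function under a distribution on a finite set. -/
def mean (p : PMF S) (f : S → ℝ) : ℝ := ∑ y, (p y).toReal * f y

lemma sum_toReal_eq_one (p : PMF S) : ∑ y, (p y).toReal = 1 := by
  rw [← ENNReal.toReal_sum fun a _ => p.apply_ne_top a, ← tsum_fintype (L := .unconditional _),
    p.tsum_coe, ENNReal.toReal_one]

lemma mean_const (p : PMF S) (c : ℝ) : mean p (fun _ => c) = c := by
  rw [mean, ← Finset.sum_mul, sum_toReal_eq_one, one_mul]

lemma mean_add (p : PMF S) (f g : S → ℝ) :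
    mean p (fun y => f y + g y) = mean p f + mean p g := by
  simp [mean, mul_add, Finset.sum_add_distrib]

lemma mean_sub (p : PMF S) (f g : S → ℝ) :
    mean p (fun y => f y - g y) = mean p f - mean p g := by
  simp [mean, mul_sub, Finset.sum_sub_distrib]

lemma mean_mul_left (p : PMF S) (c : ℝ) (f : S → ℝ) :
    mean p (fun y => c * f y) = c * mean p f := by
  simp only [mean, Finset.mul_sum]
  exact Finset.sum_congr rfl fun _ _ => by ring

lemma mean_mono (p : PMF S) {f g : S → ℝ} (h : ∀ y, f y ≤ g y) : mean p f ≤ mean p g :=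
  Finset.sum_le_sum fun y _ => mul_le_mul_of_nonneg_left (h y) ENNReal.toReal_nonneg

lemma mean_nonneg (p : PMF S) {f : S → ℝ} (h : ∀ y, 0 ≤ f y) : 0 ≤ mean p f :=
  Finset.sum_nonneg fun y _ => mul_nonneg ENNReal.toReal_nonneg (h y)

lemma mean_bind (p : PMF S) (K : S → PMF T) (f : T → ℝ) :
    mean (p.bind K) f = mean p (fun x => mean (K x) f) := by
  simp only [mean, PMF.bind_apply, tsum_fintype, Finset.mul_sum]
  rw [Finset.sum_comm]
  refine Finset.sum_congr rfl fun y _ => ?_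
  rw [ENNReal.toReal_sum fun a _ => ENNReal.mul_ne_top (p.apply_ne_top a) ((K a).apply_ne_top y),
    Finset.sum_mul]
  refine Finset.sum_congr rfl fun x _ => ?_
  rw [ENNReal.toReal_mul, mul_assoc]

lemma mean_pure (a : S) (f : S → ℝ) : mean (PMF.pure a) f = f a := by
  classical
  rw [mean, Finset.sum_eq_single a]
  · simp
  · intro b _ hb
    simp [PMF.pure_apply, hb]
  · simp

lemma mean_map (p : PMF S) (e : S → T) (f : T → ℝ) :
    mean (p.map e) f = mean p (fun x => f (e x)) := by
  rw [PMF.map, mean_bind]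
  simp [mean_pure]

/-- Every real function that is harmonic for the chain `K` is constant. On a finite space this says
that the chain has a single recurrent class; transient states are allowed. -/
def IsLiouville (K : S → PMF S) : Prop :=
  ∀ h : S → ℝ, (∀ x, h x = mean (K x) h) → ∀ x y, h x = h y

/-- The maximum principle: where a harmonic function attains its maximum, it is equal to this
maximum at all successors too. -/
lemma IsIrreducibleChain.isLiouville {K : S → PMF S} (hK : IsIrreducibleChain K) :
    IsLiouville K := by
  intro h hh x y
  obtain ⟨z, -, hz⟩ := Finset.exists_max_image Finset.univ h ⟨x, Finset.mem_univ x⟩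
  have step : ∀ a b, b ∈ (K a).support → h a = h z → h b = h z := by
    intro a b hb ha
    by_contra hne
    have hlt : h b < h z := lt_of_le_of_ne (hz b (Finset.mem_univ b)) hne
    have : mean (K a) h < mean (K a) (fun _ => h z) :=
      Finset.sum_lt_sum
        (fun y _ => mul_le_mul_of_nonneg_left (hz y (Finset.mem_univ y)) ENNReal.toReal_nonneg)
        ⟨b, Finset.mem_univ b, mul_lt_mul_of_pos_left hlt (toReal_pos_of_mem_support hb)⟩
    rw [mean_const, ← hh, ha] at this
    exact lt_irrefl _ this
  have key : ∀ w, h w = h z := fun w => by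
    induction hK z w with
    | refl => rfl
    | tail _ hbc ih => exact step _ _ hbc ih
  rw [key x, key y]

/-- The Poisson equation `g - K g = f - μ(f)` is solvable: the range of `1 - K` is contained in the
kernel of `μ`, and both have codimension one, since the kernel of `1 - K` consists of the
constants. -/
lemma IsLiouville.exists_poisson {K : S → PMF S} (hK : IsLiouville K) {μ : PMF S}
    (hμ : IsStationary K μ) (f : S → ℝ) :
    ∃ g : S → ℝ, ∀ x, f x - mean μ f = g x - mean (K x) g := by
  classical
  obtain ⟨z, hz⟩ := μ.support_nonempty
  let T : (S → ℝ) →ₗ[ℝ] (S → ℝ) :=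
    { toFun := fun g x => g x - mean (K x) g
      map_add' := fun g₁ g₂ => by
        funext x
        have := mean_add (K x) g₁ g₂
        simp only [Pi.add_apply]
        change g₁ x + g₂ x - mean (K x) (fun y => g₁ y + g₂ y) = _
        rw [this]; ring
      map_smul' := fun c g => by
        funext x
        change c * g x - mean (K x) (fun y => c * g y) = c * (g x - mean (K x) g)
        rw [mean_mul_left]; ring }
  let ℓ : (S → ℝ) →ₗ[ℝ] ℝ :=
    { toFun := fun g => mean μ g
      map_add' := fun g₁ g₂ => mean_add μ g₁ g₂
      map_smul' := fun c g => mean_mul_left μ c g }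
  have hTℓ : LinearMap.range T ≤ LinearMap.ker ℓ := by
    rintro _ ⟨g, rfl⟩
    change mean μ (fun x => g x - mean (K x) g) = 0
    rw [mean_sub, ← mean_bind, hμ, sub_self]
  have hker : LinearMap.ker T = Submodule.span ℝ {fun _ => (1 : ℝ)} := by
    ext g
    rw [LinearMap.mem_ker, Submodule.mem_span_singleton]
    constructor
    · intro hg
      have : ∀ x, g x = mean (K x) g := fun x => sub_eq_zero.1 (congrFun hg x)
      exact ⟨g z, by funext x; simp [hK g this x z]⟩
    · rintro ⟨c, rfl⟩
      funext x
      change c * 1 - mean (K x) (fun _ => c * 1) = 0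
      rw [mean_const, sub_self]
  have hker1 : Module.finrank ℝ (LinearMap.ker T) = 1 := by
    rw [hker]
    exact finrank_span_singleton fun h => one_ne_zero (congrFun h z)
  have hℓ : LinearMap.range ℓ = ⊤ := by
    refine LinearMap.range_eq_top.2 fun c => ⟨fun _ => c, mean_const μ c⟩
  have hT := LinearMap.finrank_range_add_finrank_ker T
  have hL := LinearMap.finrank_range_add_finrank_ker ℓ
  rw [hℓ, finrank_top, Module.finrank_self] at hL
  have heq := Submodule.eq_of_le_of_finrank_eq hTℓ (by omega)
  have hmem : (fun x => f x - mean μ f) ∈ LinearMap.ker ℓ := by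
    change mean μ (fun x => f x - mean μ f) = 0
    rw [mean_sub, mean_const, sub_self]
  rw [← heq] at hmem
  obtain ⟨g, hg⟩ := hmem
  exact ⟨g, fun x => (congrFun hg x).symm⟩

end Chain

/-! ### Exponential bounds and the law of large numbers along the observations -/

/-- The homogeneous Markov model with initial law `m` and transition probabilities `K`. -/
def chainModel {S : Type*} (m : PMF S) (K : S → PMF S) : SeqModel S where
  init := m
  next n h := K (h ⟨n, Finset.mem_Iic.2 le_rfl⟩)

section PairSum

variable {S : Type*}

/-- `∑_{i < n} ψ(Y_{k+i}, Y_{k+i+1})`, the sum of `ψ` over `n` transitions from time `k` on. -/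
def pairSum (ψ : S → S → ℝ) (k n : ℕ) (y : ℕ → S) : ℝ :=
  ∑ i ∈ Finset.range n, ψ (y (k + i)) (y (k + i + 1))

lemma dependsOn_pairSum (ψ : S → S → ℝ) (k n : ℕ) :
    DependsOn (pairSum ψ k n) (Set.Iic (k + n)) := by
  intro y z h
  refine Finset.sum_congr rfl fun i hi => ?_
  have := Finset.mem_range.1 hi
  rw [h (k + i) (Set.mem_Iic.2 (by omega)), h (k + i + 1) (Set.mem_Iic.2 (by omega))]

variable [Fintype S]

/-- Hoeffding-type bound for one step: `e^x ≤ 1 + x + x²` for `|x| ≤ 1`. -/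
lemma sum_mul_exp_le (p : PMF S) {f : S → ℝ} (hf : mean p f = 0) {B l : ℝ} (hB : ∀ y, |f y| ≤ B)
    (hl : 0 ≤ l) (hlB : l * B ≤ 1) :
    ∑ b, p b * ENNReal.ofReal (Real.exp (l * f b)) ≤ ENNReal.ofReal (Real.exp (l ^ 2 * B ^ 2)) := by
  have h1 : ∑ b, p b * ENNReal.ofReal (Real.exp (l * f b)) =
      ENNReal.ofReal (mean p fun b => Real.exp (l * f b)) := by
    rw [mean, ENNReal.ofReal_sum_of_nonneg fun b _ => by positivity]
    refine Finset.sum_congr rfl fun b _ => ?_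
    rw [ENNReal.ofReal_mul ENNReal.toReal_nonneg, ENNReal.ofReal_toReal (p.apply_ne_top b)]
  rw [h1]
  refine ENNReal.ofReal_le_ofReal ?_
  calc mean p (fun b => Real.exp (l * f b))
      ≤ mean p (fun b => (1 + l ^ 2 * B ^ 2) + l * f b) := by
        refine mean_mono p fun b => ?_
        have hx : |l * f b| ≤ l * B := by
          rw [abs_mul, abs_of_nonneg hl]
          exact mul_le_mul_of_nonneg_left (hB b) hl
        have h2 := (abs_le.1 (Real.abs_exp_sub_one_sub_id_le (hx.trans hlB))).2
        have h3 : (l * f b) ^ 2 ≤ (l * B) ^ 2 := sq_le_sq' (by linarith [(abs_le.1 hx).1])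
          (abs_le.1 hx).2
        nlinarith
    _ = 1 + l ^ 2 * B ^ 2 := by rw [mean_add, mean_const, mean_mul_left, hf]; ring
    _ ≤ Real.exp (l ^ 2 * B ^ 2) := by linarith [Real.add_one_le_exp (l ^ 2 * B ^ 2)]

/-- A choice of the Chernoff parameter that makes the exponent at most `-(l ε / 2) n`
for the threshold `ε n`. -/
lemma exists_chernoff_parameter {B ε : ℝ} (hB : 0 ≤ B) (hε : 0 < ε) :
    ∃ l : ℝ, 0 < l ∧ l * B ≤ 1 ∧ l ^ 2 * B ^ 2 ≤ l * ε / 2 := by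
  refine ⟨min (1 / (B + 1)) (ε / (2 * (B ^ 2 + 1))), by positivity, ?_, ?_⟩
  · calc _ ≤ 1 / (B + 1) * B := by gcongr; exact min_le_left _ _
      _ ≤ 1 := by rw [one_div_mul_eq_div, div_le_one (by positivity)]; linarith
  · set l := min (1 / (B + 1)) (ε / (2 * (B ^ 2 + 1))) with hl
    have hl0 : 0 < l := by positivity
    have h1 : l * (2 * (B ^ 2 + 1)) ≤ ε := (le_div_iff₀ (by positivity)).1 (min_le_right _ _)
    nlinarith [mul_le_mul_of_nonneg_left h1 hl0.le]

lemma exists_abs_le (ψ : S → S → ℝ) : ∃ B, 0 ≤ B ∧ ∀ a b, |ψ a b| ≤ B := by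
  refine ⟨∑ a, ∑ b, |ψ a b|, by positivity, fun a b => ?_⟩
  calc |ψ a b| ≤ ∑ b, |ψ a b| :=
        Finset.single_le_sum (f := fun b => |ψ a b|) (fun _ _ => abs_nonneg _) (Finset.mem_univ b)
    _ ≤ _ := Finset.single_le_sum (f := fun a => ∑ b, |ψ a b|)
        (fun _ _ => by positivity) (Finset.mem_univ a)

/-- The stationary mean `∑ x, μ x ∑ y, K x y * φ x y` of a function of a transition. -/
def pairMean (μ : PMF S) (K : S → PMF S) (φ : S → S → ℝ) : ℝ := mean μ fun x => mean (K x) (φ x)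

/-- Up to a bounded telescoping term, the sum of `φ - pairMean φ` over transitions is a martingale:
`g` is the solution of the Poisson equation. -/
lemma IsLiouville.exists_centred {K : S → PMF S} (hK : IsLiouville K) {μ : PMF S}
    (hμ : IsStationary K μ) (φ : S → S → ℝ) :
    ∃ (ψ : S → S → ℝ) (g : S → ℝ), (∀ a, mean (K a) (ψ a) = 0) ∧
      ∀ k n y, pairSum φ k n y =
        pairSum ψ k n y + n * pairMean μ K φ + (g (y k) - g (y (k + n))) := by
  obtain ⟨g, hg⟩ := hK.exists_poisson hμ fun x => mean (K x) (φ x)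
  refine ⟨fun a b => φ a b + g b - (mean (K a) (φ a) + mean (K a) g), g, fun a => ?_, ?_⟩
  · rw [mean_sub, mean_add, mean_const, sub_self]
  · intro k n y
    induction n with
    | zero => simp [pairSum]
    | succ n ih =>
      have hs : ∀ θ : S → S → ℝ,
          pairSum θ k (n + 1) y = pairSum θ k n y + θ (y (k + n)) (y (k + n + 1)) :=
        fun θ => Finset.sum_range_succ _ _
      rw [hs, hs, ih]
      have := hg (y (k + n))
      simp only [pairMean, ← add_assoc] at this ⊢
      push_cast
      linarith

end PairSum

section Traj

variable {S : Type*} [Fintype S] [MeasurableSpace S] [MeasurableSingletonClass S]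

instance (f₀ f₁ : SeqModel S) (ν : ℕ) : IsProbabilityMeasure (changeLaw f₀ f₁ ν) := by
  unfold changeLaw
  infer_instance

lemma lintegral_toMeasure (p : PMF S) (f : S → ℝ≥0∞) :
    ∫⁻ y, f y ∂p.toMeasure = ∑ y, p y * f y := by
  rw [lintegral_fintype]
  refine Finset.sum_congr rfl fun y _ => ?_
  rw [p.toMeasure_apply_singleton y (measurableSet_singleton y), mul_comm]

lemma measurable_of_dependsOn {β : Type*} [MeasurableSpace β] {F : (ℕ → S) → β} {n : ℕ}
    (hF : DependsOn F (Set.Iic n)) : Measurable F := by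
  rcases isEmpty_or_nonempty S with hS | ⟨⟨s⟩⟩
  · exact measurable_of_empty F
  let G : ((Finset.Iic n) → S) → β :=
    fun h => F fun i => if hi : i ≤ n then h ⟨i, Finset.mem_Iic.2 hi⟩ else s
  have hFG : F = G ∘ Preorder.frestrictLe n := by
    funext y
    refine hF fun i hi => ?_
    simp [Set.mem_Iic.1 hi]
  rw [hFG]
  exact (measurable_of_finite G).comp (by fun_prop)

/-- The Markov property at time `n`, once the post-change chain drives the next observation. -/
lemma lintegral_step (f₀ : SeqModel S) (m : PMF S) (K : S → PMF S) {ν n : ℕ} (hν : ν ≤ n + 1)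
    {F : (ℕ → S) → ℝ≥0∞} (hF : DependsOn F (Set.Iic n)) (φ : S → S → ℝ≥0∞) :
    ∫⁻ y, F y * φ (y n) (y (n + 1)) ∂(changeLaw f₀ (chainModel m K) ν) =
      ∫⁻ y, F y * ∑ b, K (y n) b * φ (y n) b ∂(changeLaw f₀ (chainModel m K) ν) := by
  obtain ⟨s, -⟩ := m.support_nonempty
  set P := changeLaw f₀ (chainModel m K) ν
  let G : ((Finset.Iic n) → S) → ℝ≥0∞ :=
    fun h => F fun i => if hi : i ≤ n then h ⟨i, Finset.mem_Iic.2 hi⟩ else s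
  have hFG : ∀ y, F y = G (Preorder.frestrictLe n y) := by
    intro y
    refine hF fun i hi => ?_
    simp [Set.mem_Iic.1 hi]
  let l : Finset.Iic n := ⟨n, Finset.mem_Iic.2 le_rfl⟩
  have hker := Kernel.map_frestrictLe_trajMeasure_compProd_eq_map_trajMeasure
    (X := fun _ => S) (μ₀ := (changeInit f₀ (chainModel m K) ν).toMeasure)
    (κ := changeKernel f₀ (chainModel m K) ν) (a := n)
  have h1 := congrArg
    (fun μ => ∫⁻ z : ((Finset.Iic n) → S) × S, G z.1 * φ (z.1 l) z.2 ∂μ) hker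
  rw [Measure.lintegral_compProd (measurable_of_finite _),
    lintegral_map (measurable_of_finite _) (by fun_prop),
    lintegral_map (measurable_of_finite _) (by fun_prop)] at h1
  simp only [hFG]
  refine h1.symm.trans (lintegral_congr fun y => ?_)
  have hk : changeKernel f₀ (chainModel m K) ν n (Preorder.frestrictLe n y) =
      (K (y n)).toMeasure := by
    change (if n + 1 < ν then _ else _) = _
    rw [if_neg (by omega)]
    rfl
  rw [hk, lintegral_toMeasure, Finset.mul_sum]
  refine Finset.sum_congr rfl fun b _ => ?_
  change _ * (G _ * φ (y n) b) = _
  ring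

/-- The exponential supermartingale bound for a sum of centred terms, on an event of the past. -/
lemma lintegral_exp_pairSum_le (f₀ : SeqModel S) (m : PMF S) (K : S → PMF S) {ν k : ℕ}
    (hν : ν ≤ k + 1) {ψ : S → S → ℝ} (hψ : ∀ a, mean (K a) (ψ a) = 0) {B l : ℝ}
    (hB : ∀ a b, |ψ a b| ≤ B) (hl : 0 ≤ l) (hlB : l * B ≤ 1)
    {F : (ℕ → S) → ℝ≥0∞} (hF : DependsOn F (Set.Iic k)) (n : ℕ) :
    ∫⁻ y, F y * ENNReal.ofReal (Real.exp (l * pairSum ψ k n y))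
        ∂(changeLaw f₀ (chainModel m K) ν) ≤
      ENNReal.ofReal (Real.exp (l ^ 2 * B ^ 2 * n)) *
        ∫⁻ y, F y ∂(changeLaw f₀ (chainModel m K) ν) := by
  induction n with
  | zero => simp [pairSum]
  | succ n ih =>
    have hdep : DependsOn (fun y => F y * ENNReal.ofReal (Real.exp (l * pairSum ψ k n y)))
        (Set.Iic (k + n)) := by
      intro y z h
      have h1 : F y = F z := hF fun i hi => h i (Set.mem_Iic.2 (by
        have := Set.mem_Iic.1 hi; omega))
      have h2 := dependsOn_pairSum ψ k n h
      simp only [h1, h2]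
    have hsplit : ∀ y, F y * ENNReal.ofReal (Real.exp (l * pairSum ψ k (n + 1) y)) =
        F y * ENNReal.ofReal (Real.exp (l * pairSum ψ k n y)) *
          (fun a b => ENNReal.ofReal (Real.exp (l * ψ a b))) (y (k + n)) (y (k + n + 1)) := by
      intro y
      simp only [pairSum, Finset.sum_range_succ]
      rw [mul_add, Real.exp_add, ENNReal.ofReal_mul (Real.exp_pos _).le, mul_assoc]
    simp only [hsplit]
    rw [lintegral_step f₀ m K (by omega) hdep
      (fun a b => ENNReal.ofReal (Real.exp (l * ψ a b)))]
    calc _ ≤ ∫⁻ y, F y * ENNReal.ofReal (Real.exp (l * pairSum ψ k n y)) *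
          ENNReal.ofReal (Real.exp (l ^ 2 * B ^ 2)) ∂(changeLaw f₀ (chainModel m K) ν) := by
          gcongr with y
          exact sum_mul_exp_le _ (hψ _) (hB _) hl hlB
      _ = (∫⁻ y, F y * ENNReal.ofReal (Real.exp (l * pairSum ψ k n y))
            ∂(changeLaw f₀ (chainModel m K) ν)) * ENNReal.ofReal (Real.exp (l ^ 2 * B ^ 2)) :=
          lintegral_mul_const _ (measurable_of_dependsOn hdep)
      _ ≤ (ENNReal.ofReal (Real.exp (l ^ 2 * B ^ 2 * n)) *
            ∫⁻ y, F y ∂(changeLaw f₀ (chainModel m K) ν)) *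
              ENNReal.ofReal (Real.exp (l ^ 2 * B ^ 2)) := by gcongr
      _ = _ := by
          rw [mul_right_comm, ← ENNReal.ofReal_mul (Real.exp_pos _).le, ← Real.exp_add]
          congr 3
          push_cast
          ring

/-- Chernoff bound, uniform over the events `A` of the past. -/
lemma measure_inter_pairSum_ge_le (f₀ : SeqModel S) (m : PMF S) (K : S → PMF S) {ν k : ℕ}
    (hν : ν ≤ k + 1) {ψ : S → S → ℝ} (hψ : ∀ a, mean (K a) (ψ a) = 0) {B l : ℝ}
    (hB : ∀ a b, |ψ a b| ≤ B) (hl : 0 ≤ l) (hlB : l * B ≤ 1)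
    {A : Set (ℕ → S)} (hA : DependsOn (fun y => y ∈ A) (Set.Iic k)) (n : ℕ) (t : ℝ) :
    changeLaw f₀ (chainModel m K) ν (A ∩ {y | t ≤ pairSum ψ k n y}) ≤
      ENNReal.ofReal (Real.exp (l ^ 2 * B ^ 2 * n - l * t)) *
        changeLaw f₀ (chainModel m K) ν A := by
  set P := changeLaw f₀ (chainModel m K) ν
  let F : (ℕ → S) → ℝ≥0∞ := A.indicator 1
  have hF : DependsOn F (Set.Iic k) := by
    intro y z h
    classical
    have : (y ∈ A) = (z ∈ A) := hA h
    simp only [F, Set.indicator_apply, this, Pi.one_apply]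
  have hAm : MeasurableSet A := measurable_of_dependsOn (β := Prop) hA |>.setOf
  have hint : ∫⁻ y, F y ∂P = P A := lintegral_indicator_one hAm
  have hbd := lintegral_exp_pairSum_le f₀ m K hν hψ hB hl hlB hF n
  rw [hint] at hbd
  have hEm : MeasurableSet (A ∩ {y | t ≤ pairSum ψ k n y}) :=
    hAm.inter (measurableSet_le measurable_const
      (measurable_of_dependsOn (dependsOn_pairSum ψ k n)))
  have hle : ENNReal.ofReal (Real.exp (l * t)) * P (A ∩ {y | t ≤ pairSum ψ k n y}) ≤
      ENNReal.ofReal (Real.exp (l ^ 2 * B ^ 2 * n)) * P A := by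
    refine le_trans ?_ hbd
    rw [← lintegral_indicator_one hEm, ← lintegral_const_mul' _ _ ENNReal.ofReal_ne_top]
    refine lintegral_mono fun y => ?_
    by_cases hy : y ∈ A ∩ {y | t ≤ pairSum ψ k n y}
    · rw [Set.indicator_of_mem hy]
      simp only [F, Set.indicator_of_mem hy.1, Pi.one_apply, mul_one, one_mul]
      gcongr
      exact hy.2
    · rw [Set.indicator_of_notMem hy, mul_zero]
      exact zero_le
  calc P (A ∩ {y | t ≤ pairSum ψ k n y})
      = ENNReal.ofReal (Real.exp (-(l * t))) *
          (ENNReal.ofReal (Real.exp (l * t)) * P (A ∩ {y | t ≤ pairSum ψ k n y})) := by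
        rw [← mul_assoc, ← ENNReal.ofReal_mul (Real.exp_pos _).le, ← Real.exp_add]
        simp
    _ ≤ ENNReal.ofReal (Real.exp (-(l * t))) *
          (ENNReal.ofReal (Real.exp (l ^ 2 * B ^ 2 * n)) * P A) := by gcongr
    _ = _ := by
        rw [← mul_assoc, ← ENNReal.ofReal_mul (Real.exp_pos _).le, ← Real.exp_add]
        congr 3
        ring

/-- Borel–Cantelli: the probabilities of the complementary events are bounded by a geometric
series. -/
lemma ae_eventually_pairSum_lt (f₀ : SeqModel S) (m : PMF S) (K : S → PMF S) {ν k : ℕ}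
    (hν : ν ≤ k + 1) {ψ : S → S → ℝ} (hψ : ∀ a, mean (K a) (ψ a) = 0) {ε : ℝ} (hε : 0 < ε) :
    ∀ᵐ y ∂(changeLaw f₀ (chainModel m K) ν), ∀ᶠ n : ℕ in atTop, pairSum ψ k n y < ε * n := by
  obtain ⟨B, hB0, hB⟩ := exists_abs_le ψ
  obtain ⟨l, hl, hlB, hlε⟩ := exists_chernoff_parameter hB0 hε
  have hbd : ∀ n : ℕ, changeLaw f₀ (chainModel m K) ν {y | ε * n ≤ pairSum ψ k n y} ≤
      ENNReal.ofReal (Real.exp (-(l * ε / 2)) ^ n) := by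
    intro n
    have h := measure_inter_pairSum_ge_le f₀ m K hν hψ hB hl.le hlB
      (A := Set.univ) (fun _ _ _ => rfl) n (ε * n)
    rw [Set.univ_inter, measure_univ, mul_one] at h
    refine h.trans (ENNReal.ofReal_le_ofReal ?_)
    rw [← Real.exp_nat_mul, Real.exp_le_exp]
    nlinarith [mul_le_mul_of_nonneg_right hlε (Nat.cast_nonneg (α := ℝ) n)]
  have hsum : Summable fun n : ℕ => Real.exp (-(l * ε / 2)) ^ n :=
    summable_geometric_of_lt_one (Real.exp_pos _).le (Real.exp_lt_one_iff.2 (by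
      have := mul_pos hl hε; linarith))
  have hne : ∑' n : ℕ, changeLaw f₀ (chainModel m K) ν {y | ε * n ≤ pairSum ψ k n y} ≠ ∞ :=
    ne_top_of_le_ne_top hsum.tsum_ofReal_ne_top (ENNReal.tsum_le_tsum hbd)
  filter_upwards [ae_eventually_notMem hne] with y hy
  filter_upwards [hy] with n hn
  exact not_le.1 hn

lemma ae_tendsto_pairSum_div_zero (f₀ : SeqModel S) (m : PMF S) (K : S → PMF S) {ν k : ℕ}
    (hν : ν ≤ k + 1) {ψ : S → S → ℝ} (hψ : ∀ a, mean (K a) (ψ a) = 0) :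
    ∀ᵐ y ∂(changeLaw f₀ (chainModel m K) ν),
      Tendsto (fun n : ℕ => pairSum ψ k n y / n) atTop (𝓝 0) := by
  have hψ' : ∀ a, mean (K a) (fun b => -ψ a b) = 0 := fun a => by
    simpa using (mean_mul_left (K a) (-1) (ψ a)).trans (by rw [hψ a, mul_zero])
  have h1 := fun j : ℕ =>
    ae_eventually_pairSum_lt f₀ m K hν hψ (ε := 1 / (j + 1)) Nat.one_div_pos_of_nat
  have h2 := fun j : ℕ =>
    ae_eventually_pairSum_lt f₀ m K hν hψ' (ε := 1 / (j + 1)) Nat.one_div_pos_of_nat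
  rw [← ae_all_iff] at h1 h2
  filter_upwards [h1, h2] with y hy1 hy2
  rw [Metric.tendsto_nhds]
  intro ε hε
  obtain ⟨j, hj⟩ := exists_nat_one_div_lt hε
  filter_upwards [hy1 j, hy2 j, eventually_gt_atTop 0] with n hn1 hn2 hn
  have hn0 : (0 : ℝ) < n := Nat.cast_pos.2 hn
  have hneg : pairSum (fun a b => -ψ a b) k n y = -pairSum ψ k n y := by simp [pairSum]
  rw [hneg] at hn2
  rw [Real.dist_eq, sub_zero, abs_div, abs_of_pos hn0, div_lt_iff₀ hn0, abs_lt]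
  have := mul_lt_mul_of_pos_right hj hn0
  constructor <;> linarith

/-- The strong law of large numbers for functions of a transition of the post-change chain. -/
lemma IsLiouville.ae_tendsto_pairSum_div {K : S → PMF S} (hK : IsLiouville K) {μ : PMF S}
    (hμ : IsStationary K μ) (f₀ : SeqModel S) (m : PMF S) {ν k : ℕ} (hν : ν ≤ k + 1)
    (φ : S → S → ℝ) :
    ∀ᵐ y ∂(changeLaw f₀ (chainModel m K) ν),
      Tendsto (fun n : ℕ => pairSum φ k n y / n) atTop (𝓝 (pairMean μ K φ)) := by
  obtain ⟨ψ, g, hψ, hφ⟩ := hK.exists_centred hμ φ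
  filter_upwards [ae_tendsto_pairSum_div_zero f₀ m K hν hψ] with y hy
  obtain ⟨C, -, hC⟩ := exists_abs_le fun a b => g a - g b
  have hbdd : Tendsto (fun n : ℕ => (g (y k) - g (y (k + n))) / n) atTop (𝓝 0) := by
    refine squeeze_zero_norm (fun n => ?_) (tendsto_const_div_atTop_nhds_zero_nat C)
    rw [norm_div, Real.norm_natCast, Real.norm_eq_abs]
    gcongr
    exact hC _ _
  have h := (hy.add hbdd).add_const (pairMean μ K φ)
  rw [add_zero, zero_add] at h
  refine h.congr' ?_
  filter_upwards [eventually_gt_atTop 0] with n hn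
  have hn0 : (n : ℝ) ≠ 0 := Nat.cast_ne_zero.2 hn.ne'
  rw [hφ]
  field_simp
  ring

end Traj

/-! ### The log-likelihood ratios of two Markov chains -/

/-- The log-likelihood ratio `ln (K₁(b | a) / K₀(b | a))` of a transition, as a real number. The
value is `0` if one of the two probabilities vanishes. -/
def logRatio {S : Type*} (K₀ K₁ : S → PMF S) (a b : S) : ℝ :=
  Real.log ((K₁ a b).toReal / (K₀ a b).toReal)

/-- The contribution of the first observation to the sum of log-likelihood ratios that starts at the
change time `ν`: it is present only for `ν = 0`. -/
def firstLogRatio {S : Type*} (m₀ m₁ : PMF S) (ν : ℕ) (a : S) : ℝ :=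
  if ν = 0 then Real.log ((m₁ a).toReal / (m₀ a).toReal) else 0

lemma coe_real_sum {ι : Type*} (s : Finset ι) (f : ι → ℝ) :
    ((∑ i ∈ s, f i : ℝ) : EReal) = ∑ i ∈ s, (f i : EReal) := by
  classical
  induction s using Finset.induction_on with
  | empty => simp
  | insert a s ha ih => rw [Finset.sum_insert ha, Finset.sum_insert ha, EReal.coe_add, ih]

lemma sum_ne_bot {ι : Type*} (s : Finset ι) (f : ι → EReal) (h : ∀ i ∈ s, f i ≠ ⊥) :
    ∑ i ∈ s, f i ≠ ⊥ := by
  refine Finset.sum_induction f (fun x => x ≠ ⊥) (fun x y hx hy => ?_) (by simp) h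
  rw [Ne, EReal.add_eq_bot_iff]
  tauto

/-- In `EReal` one has `⊤ + ⊥ = ⊥`, so a sum with a term `⊤` is `⊤` only if no term is `⊥`. -/
lemma sum_eq_top {ι : Type*} (s : Finset ι) (f : ι → EReal) (h : ∀ i ∈ s, f i ≠ ⊥) {j : ι}
    (hj : j ∈ s) (hfj : f j = ⊤) : ∑ i ∈ s, f i = ⊤ := by
  classical
  rw [← Finset.add_sum_erase s f hj, hfj]
  exact EReal.top_add_of_ne_bot (sum_ne_bot _ _ fun i hi => h i (Finset.mem_of_mem_erase hi))

lemma log_div_eq_coe {p q : ℝ≥0∞} (hp : p ≠ 0) (hp' : p ≠ ∞) (hq : q ≠ 0) (hq' : q ≠ ∞) :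
    ENNReal.log (p / q) = (Real.log (p.toReal / q.toReal) : ℝ) := by
  rw [ENNReal.log_pos_real (ENNReal.div_ne_zero.2 ⟨hp, hq'⟩) (ENNReal.div_ne_top hp' hq),
    ENNReal.toReal_div]

/-- A conditional probability is at most `ε` if the corresponding bound holds on every event of the
conditioning `σ`-algebra. -/
lemma condExp_indicator_le {Ω : Type*} {m m0 : MeasurableSpace Ω} {P : Measure Ω}
    [IsProbabilityMeasure P] (hm : m ≤ m0) {E : Set Ω} (hE : MeasurableSet E) {ε : ℝ} (hε : 0 ≤ ε)
    (h : ∀ A, MeasurableSet[m] A → P (A ∩ E) ≤ ENNReal.ofReal ε * P A) :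
    P⟦E|m⟧ ≤ᵐ[P] fun _ => ε := by
  refine ae_le_of_ae_le_trim (hm := hm) ?_
  have hint : Integrable (E.indicator fun _ => (1 : ℝ)) P :=
    (integrable_const _).indicator hE
  refine ae_le_of_forall_setIntegral_le
    (integrable_condExp.trim hm stronglyMeasurable_condExp) (integrable_const _) fun A hA _ => ?_
  rw [← setIntegral_trim hm stronglyMeasurable_condExp hA, setIntegral_condExp hm hint hA,
    setIntegral_indicator hE, setIntegral_const, setIntegral_const, smul_eq_mul, smul_eq_mul,
    mul_one, measureReal_def, measureReal_def, trim_measurableSet_eq hm hA, mul_comm]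
  calc (P (A ∩ E)).toReal ≤ (ENNReal.ofReal ε * P A).toReal :=
        ENNReal.toReal_mono (ENNReal.mul_ne_top ENNReal.ofReal_ne_top (measure_ne_top _ _)) (h A hA)
    _ = ε * (P A).toReal := by rw [ENNReal.toReal_mul, ENNReal.toReal_ofReal hε]

lemma pastSigma_le {S : Type*} [MeasurableSpace S] (ν : ℕ) :
    pastSigma S ν ≤ MeasurableSpace.pi := by
  refine Measurable.comap_le ?_
  fun_prop

lemma dependsOn_of_measurableSet_pastSigma {S : Type*} [MeasurableSpace S] {ν : ℕ} {A : Set (ℕ → S)}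
    (hA : MeasurableSet[pastSigma S ν] A) : DependsOn (fun y => y ∈ A) (Set.Iic (ν - 1)) := by
  obtain ⟨B, -, rfl⟩ := hA
  intro y z h
  have : (fun i : Fin ν => y i) = fun i : Fin ν => z i := by
    funext i
    exact h i (Set.mem_Iic.2 (by have := i.2; omega))
  simp only [Set.mem_preimage, this]

section Chains

variable {S : Type*} [Fintype S] [MeasurableSpace S] [MeasurableSingletonClass S]

/-- After the change only transitions of the post-change chain occur. -/
lemma ae_mem_support_step (f₀ : SeqModel S) (m : PMF S) (K : S → PMF S) (ν : ℕ) :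
    ∀ᵐ y ∂(changeLaw f₀ (chainModel m K) ν), ∀ t, ν ≤ t + 1 → K (y t) (y (t + 1)) ≠ 0 := by
  classical
  rw [ae_all_iff]
  intro t
  by_cases ht : ν ≤ t + 1
  · have h := lintegral_step f₀ m K ht (F := fun _ => 1) (fun _ _ _ => rfl)
      (fun a b => if K a b = 0 then 1 else 0)
    have h0 : ∀ a, ∑ b, K a b * (if K a b = 0 then (1 : ℝ≥0∞) else 0) = 0 := fun a =>
      Finset.sum_eq_zero fun b _ => by split_ifs with hb <;> simp [hb]
    simp only [h0, one_mul, lintegral_zero] at h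
    have hm : Measurable fun y : ℕ → S => if K (y t) (y (t + 1)) = 0 then (1 : ℝ≥0∞) else 0 :=
      measurable_of_dependsOn (n := t + 1) fun y z hyz => by
        rw [hyz t (Set.mem_Iic.2 (by omega)), hyz (t + 1) (Set.mem_Iic.2 le_rfl)]
    rw [lintegral_eq_zero_iff hm] at h
    filter_upwards [h] with y hy _ h0
    simp [h0] at hy
  · exact Eventually.of_forall fun _ h => absurd h ht

/-- If the change precedes all observations, then the first one has law `m`. -/
lemma ae_init_ne_zero (f₀ : SeqModel S) (m : PMF S) (K : S → PMF S) :
    ∀ᵐ y ∂(changeLaw f₀ (chainModel m K) 0), m (y 0) ≠ 0 := by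
  have hmap : (changeLaw f₀ (chainModel m K) 0).map (fun y => y 0) = m.toMeasure := by
    have h1 : (fun y : ℕ → S => y 0) =
        (fun h : (Finset.Iic 0) → S => h ⟨0, Finset.mem_Iic.2 le_rfl⟩) ∘ Preorder.frestrictLe 0 :=
      rfl
    rw [h1, ← Measure.map_map (by fun_prop) (by fun_prop)]
    unfold changeLaw Kernel.trajMeasure
    rw [Measure.map_comp _ _ (by fun_prop), Kernel.traj_map_frestrictLe, Kernel.partialTraj_self,
      Measure.id_comp, Measure.map_map (by fun_prop) (by fun_prop)]
    exact Measure.map_id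
  have h : ∀ᵐ a ∂m.toMeasure, m a ≠ 0 := by
    have : m.toMeasure {a | ¬ m a ≠ 0} = 0 := by
      rw [m.toMeasure_apply_eq_zero_iff (Set.toFinite _).measurableSet, Set.disjoint_left]
      intro a ha h
      exact h ((m.mem_support_iff a).1 ha)
    exact this
  rw [← hmap] at h
  exact ae_of_ae_map (f := fun y : ℕ → S => y 0) (p := fun a => m a ≠ 0)
    (Measurable.aemeasurable (by fun_prop)) h

variable {m₀ m₁ : PMF S} {K₀ K₁ : S → PMF S}

/-- If no log-likelihood ratio is infinite, then after the change time their sums are real numbers: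
sums over transitions, with an additional first term for `ν = 0`. -/
lemma ae_llSum_eq {ν : ℕ} (hm : ν = 0 → ∀ a, m₁ a ≠ 0 → m₀ a ≠ 0)
    (hK : ∀ a b, K₁ a b ≠ 0 → K₀ a b ≠ 0) :
    ∀ᵐ y ∂(changeLaw (chainModel m₀ K₀) (chainModel m₁ K₁) ν), ∀ n,
      llSum (chainModel m₀ K₀) (chainModel m₁ K₁) ν n y =
        ((firstLogRatio m₀ m₁ ν (y 0) +
          pairSum (logRatio K₀ K₁) (ν - 1) (n + min ν 1) y : ℝ) : EReal) := by
  have hstep : ∀ (y : ℕ → S) (t : ℕ), K₁ (y t) (y (t + 1)) ≠ 0 →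
      llRatio (chainModel m₀ K₀) (chainModel m₁ K₁) (t + 1) y =
        (logRatio K₀ K₁ (y t) (y (t + 1)) : ℝ) := fun y t h =>
    log_div_eq_coe h (PMF.apply_ne_top _ _) (hK _ _ h) (PMF.apply_ne_top _ _)
  cases ν with
  | zero =>
    filter_upwards [ae_init_ne_zero (chainModel m₀ K₀) m₁ K₁,
      ae_mem_support_step (chainModel m₀ K₀) m₁ K₁ 0] with y hy0 hy n
    have h0 : llRatio (chainModel m₀ K₀) (chainModel m₁ K₁) 0 y =
        (firstLogRatio m₀ m₁ 0 (y 0) : ℝ) := by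
      rw [firstLogRatio, if_pos rfl]
      exact log_div_eq_coe hy0 (PMF.apply_ne_top _ _) (hm rfl _ hy0) (PMF.apply_ne_top _ _)
    rw [llSum, EReal.coe_add, pairSum, coe_real_sum, zero_add]
    have hI : Finset.Icc 0 n = Finset.range (n + 1) := by ext i; simp
    rw [hI, Finset.sum_range_succ', h0, add_comm]
    refine congrArg _ (Finset.sum_congr rfl fun i _ => ?_)
    simp only [Nat.zero_sub, zero_add]
    exact hstep y i (hy i (Nat.zero_le _))
  | succ k =>
    filter_upwards [ae_mem_support_step (chainModel m₀ K₀) m₁ K₁ (k + 1)] with y hy n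
    rw [firstLogRatio, if_neg (Nat.succ_ne_zero k), zero_add, llSum, pairSum, coe_real_sum]
    have hI : Finset.Icc (k + 1) (k + 1 + n) =
        (Finset.range (n + 1)).map (addRightEmbedding (k + 1)) := by
      ext i
      simp only [Finset.mem_Icc, Finset.mem_map, Finset.mem_range, addRightEmbedding_apply]
      exact ⟨fun h => ⟨i - (k + 1), by omega, by omega⟩, by rintro ⟨j, hj, rfl⟩; omega⟩
    rw [hI, Finset.sum_map]
    have hmin : min (k + 1) 1 = 1 := by omega
    rw [hmin, Nat.add_sub_cancel]
    refine Finset.sum_congr rfl fun i _ => ?_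
    have := hstep y (k + i) (hy (k + i) (by omega))
    rw [addRightEmbedding_apply, show i + (k + 1) = k + i + 1 by omega, this]

/-- The averages of the log-likelihood ratios converge to their stationary mean. -/
lemma IsLiouville.ae_tendsto_llSum_div (hL : IsLiouville K₁) {μ : PMF S} (hμ : IsStationary K₁ μ)
    {ν : ℕ} (hm : ν = 0 → ∀ a, m₁ a ≠ 0 → m₀ a ≠ 0)
    (hK : ∀ a b, K₁ a b ≠ 0 → K₀ a b ≠ 0) :
    ∀ᵐ y ∂(changeLaw (chainModel m₀ K₀) (chainModel m₁ K₁) ν),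
      Tendsto (fun n : ℕ => llSum (chainModel m₀ K₀) (chainModel m₁ K₁) ν n y / (n : EReal)) atTop
        (𝓝 ((pairMean μ K₁ (logRatio K₀ K₁) : ℝ) : EReal)) := by
  filter_upwards [ae_llSum_eq hm hK, hL.ae_tendsto_pairSum_div hμ (chainModel m₀ K₀) m₁
    (ν := ν) (k := ν - 1) (by omega) (logRatio K₀ K₁)] with y hy hlim
  set c := firstLogRatio m₀ m₁ ν (y 0)
  set e := min ν 1
  have h1 := hlim.comp (tendsto_add_atTop_nat e)
  have h2 : Tendsto (fun n : ℕ => ((n : ℝ) + e) / n) atTop (𝓝 1) := by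
    have := (tendsto_const_div_atTop_nhds_zero_nat (e : ℝ)).const_add 1
    rw [add_zero] at this
    refine this.congr' ?_
    filter_upwards [eventually_gt_atTop 0] with n hn
    have hn0 : (n : ℝ) ≠ 0 := Nat.cast_ne_zero.2 hn.ne'
    field_simp
  have h3 := (h1.mul h2).add (tendsto_const_div_atTop_nhds_zero_nat c)
  rw [mul_one, add_zero] at h3
  have h4 := (continuous_coe_real_ereal.tendsto _).comp h3
  refine h4.congr' ?_
  filter_upwards [eventually_gt_atTop 0] with n hn
  have hn0 : (n : ℝ) ≠ 0 := Nat.cast_ne_zero.2 hn.ne'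
  have hne : (n : ℝ) + e ≠ 0 := by positivity
  simp only [Function.comp_apply]
  rw [hy n, ← EReal.coe_natCast, ← EReal.coe_div]
  refine congrArg Real.toEReal ?_
  push_cast
  field_simp
  ring

lemma measurableSet_exceedEvent (f₀ f₁ : SeqModel S) (I δ : ℝ) (ν n : ℕ) :
    MeasurableSet (exceedEvent f₀ f₁ I δ ν n) := by
  have hd : ∀ (f : SeqModel S) (t : ℕ), Measurable fun y => f.density y t := by
    intro f t
    refine measurable_of_dependsOn (n := t) fun y z h => ?_
    cases t with
    | zero => exact congrArg f.init (h 0 (Set.mem_Iic.2 le_rfl))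
    | succ t =>
      have h1 : (fun i : Finset.Iic t => y i) = fun i : Finset.Iic t => z i := by
        funext i
        exact h i (Set.mem_Iic.2 ((Finset.mem_Iic.1 i.2).trans (Nat.le_succ t)))
      change f.next t (fun i => y i) (y (t + 1)) = f.next t (fun i => z i) (z (t + 1))
      rw [h1, h (t + 1) (Set.mem_Iic.2 le_rfl)]
  have hs : ∀ t, Measurable (llSum f₀ f₁ ν t) := fun t =>
    Finset.measurable_sum _ fun i _ => ((hd f₁ i).div (hd f₀ i)).ennreal_log
  have hE : exceedEvent f₀ f₁ I δ ν n =
      ⋃ t ∈ Finset.range (n + 1), {y | ((I * (1 + δ) * n : ℝ) : EReal) ≤ llSum f₀ f₁ ν t y} := by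
    ext y
    rw [Set.mem_iUnion₂]
    exact (Finset.le_sup_iff (EReal.bot_lt_coe _)).trans (by simp)
  rw [hE]
  exact Finset.measurableSet_biUnion _ fun t _ => measurableSet_le measurable_const (hs t)

/-- On every event of the past the maximum of the sums of log-likelihood ratios exceeds
`I (1 + δ) n` with exponentially small conditional probability, uniformly in the change time. -/
lemma IsLiouville.exists_exceed_bound (hL : IsLiouville K₁) {μ : PMF S} (hμ : IsStationary K₁ μ)
    (hm : ∀ a, m₁ a ≠ 0 → m₀ a ≠ 0) (hK : ∀ a b, K₁ a b ≠ 0 → K₀ a b ≠ 0)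
    (hI : 0 < pairMean μ K₁ (logRatio K₀ K₁)) {δ : ℝ} (hδ : 0 < δ) :
    ∃ C r : ℝ, 0 ≤ C ∧ 0 ≤ r ∧ r < 1 ∧ ∀ (ν n : ℕ) (A : Set (ℕ → S)),
      MeasurableSet[pastSigma S ν] A →
      changeLaw (chainModel m₀ K₀) (chainModel m₁ K₁) ν (A ∩ exceedEvent (chainModel m₀ K₀)
          (chainModel m₁ K₁) (pairMean μ K₁ (logRatio K₀ K₁)) δ ν n) ≤
        ENNReal.ofReal ((n + 2) * (C * r ^ n)) *
          changeLaw (chainModel m₀ K₀) (chainModel m₁ K₁) ν A := by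
  set I := pairMean μ K₁ (logRatio K₀ K₁)
  obtain ⟨ψ, g, hψ, hφ⟩ := hL.exists_centred hμ (logRatio K₀ K₁)
  obtain ⟨B, hB0, hB⟩ := exists_abs_le ψ
  obtain ⟨G, hG0, hG⟩ := exists_abs_le fun a b => g a - g b
  obtain ⟨Z, hZ0, hZ⟩ := exists_abs_le fun a (_ : S) => firstLogRatio m₀ m₁ 0 a
  obtain ⟨l, hl, hlB, hlε⟩ := exists_chernoff_parameter hB0 (mul_pos hI hδ)
  have hZ' : ∀ ν a, firstLogRatio m₀ m₁ ν a ≤ Z := by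
    intro ν a
    rcases Nat.eq_zero_or_pos ν with rfl | h
    · exact (le_abs_self _).trans (hZ a a)
    · rw [firstLogRatio, if_neg h.ne']; exact hZ0
  -- the sums of the `ψ` have to exceed `I δ n - c`
  set c := I + Z + G with hc
  have hrpos : 0 < l * (I * δ) := by positivity
  refine ⟨Real.exp (l * (I * δ) / 2 + l * c), Real.exp (-(l * (I * δ) / 2)), (Real.exp_pos _).le,
    (Real.exp_pos _).le, Real.exp_lt_one_iff.2 (by linarith), fun ν n A hA => ?_⟩
  set P := changeLaw (chainModel m₀ K₀) (chainModel m₁ K₁) ν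
  have hsub : (A ∩ exceedEvent (chainModel m₀ K₀) (chainModel m₁ K₁) I δ ν n : Set (ℕ → S))
      ≤ᵐ[P] (⋃ j ∈ Finset.range (n + 2), A ∩ {y | I * δ * n - c ≤ pairSum ψ (ν - 1) j y} :
        Set (ℕ → S)) := by
    filter_upwards [ae_llSum_eq (fun _ => hm) hK] with y hy hyE
    obtain ⟨hyA, hyE⟩ := hyE
    obtain ⟨t, ht, hle⟩ := (Finset.le_sup_iff (EReal.bot_lt_coe _)).1 hyE
    rw [hy t, EReal.coe_le_coe_iff, hφ] at hle
    have htn : t + min ν 1 ≤ n + 1 := by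
      have := Finset.mem_range.1 ht; omega
    refine Set.mem_biUnion (Finset.mem_coe.2 (Finset.mem_range.2 (Nat.lt_succ_of_le htn)))
      ⟨hyA, ?_⟩
    have h1 : ((t + min ν 1 : ℕ) : ℝ) * I ≤ (n + 1) * I := by
      gcongr
      exact_mod_cast htn
    have h2 := (le_abs_self _).trans (hG (y (ν - 1)) (y (ν - 1 + (t + min ν 1))))
    have h3 := hZ' ν (y 0)
    change I * δ * n - c ≤ pairSum ψ (ν - 1) (t + min ν 1) y
    rw [hc]
    linarith
  calc P (A ∩ exceedEvent (chainModel m₀ K₀) (chainModel m₁ K₁) I δ ν n)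
      ≤ P (⋃ j ∈ Finset.range (n + 2), A ∩ {y | I * δ * n - c ≤ pairSum ψ (ν - 1) j y}) :=
        measure_mono_ae hsub
    _ ≤ ∑ j ∈ Finset.range (n + 2), P (A ∩ {y | I * δ * n - c ≤ pairSum ψ (ν - 1) j y}) :=
        measure_biUnion_finset_le _ _
    _ ≤ ∑ _j ∈ Finset.range (n + 2), ENNReal.ofReal (Real.exp (l * (I * δ) / 2 + l * c) *
          Real.exp (-(l * (I * δ) / 2)) ^ n) * P A := by
        refine Finset.sum_le_sum fun j hj => ?_
        refine (measure_inter_pairSum_ge_le (chainModel m₀ K₀) m₁ K₁ (k := ν - 1) (by omega) hψ hB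
          hl.le hlB (dependsOn_of_measurableSet_pastSigma hA) j _).trans ?_
        gcongr
        rw [← Real.exp_nat_mul, ← Real.exp_add, Real.exp_le_exp]
        have hj' : (j : ℝ) ≤ n + 1 := by
          exact_mod_cast Nat.lt_succ_iff.1 (Finset.mem_range.1 hj)
        have h1 : l ^ 2 * B ^ 2 * j ≤ l * (I * δ) / 2 * (n + 1) :=
          mul_le_mul hlε hj' (Nat.cast_nonneg j) (by positivity)
        linarith
    _ = _ := by
        rw [Finset.sum_const, Finset.card_range, nsmul_eq_mul, ← mul_assoc,
          ENNReal.ofReal_mul (by positivity : (0 : ℝ) ≤ n + 2)]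
        congr 2
        rw [ENNReal.ofReal_add (Nat.cast_nonneg n) (by norm_num), ENNReal.ofReal_natCast]
        push_cast
        simp

/-- Absolutely continuous case: the convergence assumption holds, and the constant is the stationary
mean of the log-likelihood ratio of a transition. -/
theorem IsLiouville.convergenceAssumption (hL : IsLiouville K₁) {μ : PMF S}
    (hμ : IsStationary K₁ μ) (hm : ∀ a, m₁ a ≠ 0 → m₀ a ≠ 0)
    (hK : ∀ a b, K₁ a b ≠ 0 → K₀ a b ≠ 0) (hI : 0 < pairMean μ K₁ (logRatio K₀ K₁)) :
    ConvergenceAssumption (chainModel m₀ K₀) (chainModel m₁ K₁)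
      (pairMean μ K₁ (logRatio K₀ K₁)) := by
  refine ⟨fun ν => hL.ae_tendsto_llSum_div hμ (fun _ => hm) hK, fun δ hδ => ?_⟩
  obtain ⟨C, r, hC, hr0, hr1, hbd⟩ := hL.exists_exceed_bound hμ hm hK hI hδ
  have hlim : Tendsto (fun n : ℕ => ENNReal.ofReal ((n + 2) * (C * r ^ n))) atTop (𝓝 0) := by
    have h1 := ((tendsto_self_mul_const_pow_of_lt_one hr0 hr1).add
      ((tendsto_pow_atTop_nhds_zero_of_lt_one hr0 hr1).const_mul 2)).const_mul C
    simp only [mul_zero, add_zero] at h1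
    rw [← ENNReal.ofReal_zero]
    refine ENNReal.tendsto_ofReal (h1.congr fun n => ?_)
    ring
  refine tendsto_of_tendsto_of_tendsto_of_le_of_le tendsto_const_nhds hlim
    (fun _ => zero_le) fun n => iSup_le fun ν => ?_
  refine essSup_le_of_ae_le _ ?_
  filter_upwards [condExp_indicator_le (pastSigma_le ν) (measurableSet_exceedEvent _ _ _ δ ν n)
    (by positivity) (hbd ν n)] with y hy
  exact ENNReal.ofReal_le_ofReal hy

/-- The constant of the convergence assumption is the stationary mean of the log-likelihood ratio of
a transition; for a change time `ν ≥ 1` the initial laws play no role. -/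
lemma ConvergenceAssumption.eq_pairMean {I : ℝ}
    (h : ConvergenceAssumption (chainModel m₀ K₀) (chainModel m₁ K₁) I) (hL : IsLiouville K₁)
    {μ : PMF S} (hμ : IsStationary K₁ μ) (hK : ∀ a b, K₁ a b ≠ 0 → K₀ a b ≠ 0) :
    I = pairMean μ K₁ (logRatio K₀ K₁) := by
  have hlim := hL.ae_tendsto_llSum_div (m₀ := m₀) (m₁ := m₁) (ν := 1) hμ
    (fun h => absurd h one_ne_zero) hK
  obtain ⟨y, hy1, hy2⟩ := ((h.tendsto_average 1).and hlim).exists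
  exact EReal.coe_injective (tendsto_nhds_unique hy1 hy2)

/-- Singular case: almost surely, a transition that is impossible before the change occurs after it,
and the sum of the log-likelihood ratios is infinite from then on. -/
theorem IsLiouville.not_convergenceAssumption (hL : IsLiouville K₁) {μ : PMF S}
    (hμ : IsStationary K₁ μ) {a b : S} (ha : μ a ≠ 0) (hb : K₁ a b ≠ 0) (hb0 : K₀ a b = 0) (I : ℝ) :
    ¬ ConvergenceAssumption (chainModel m₀ K₀) (chainModel m₁ K₁) I := by
  classical
  intro h
  let φ : S → S → ℝ := fun x x' => if x = a ∧ x' = b then 1 else 0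
  have hφ : 0 < pairMean μ K₁ φ := by
    have hφ0 : ∀ x x', 0 ≤ φ x x' := fun x x' => by dsimp only [φ]; split_ifs <;> norm_num
    refine Finset.sum_pos' (fun x _ => mul_nonneg ENNReal.toReal_nonneg (mean_nonneg _ (hφ0 x)))
      ⟨a, Finset.mem_univ a, mul_pos (toReal_pos_of_mem_support ((μ.mem_support_iff a).2 ha)) ?_⟩
    refine Finset.sum_pos' (fun x _ => mul_nonneg ENNReal.toReal_nonneg (hφ0 a x))
      ⟨b, Finset.mem_univ b, mul_pos
        (toReal_pos_of_mem_support (((K₁ a).mem_support_iff b).2 hb)) ?_⟩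
    simp [φ]
  obtain ⟨y, hy1, hy2, hy3⟩ := ((h.tendsto_average 1).and
    ((hL.ae_tendsto_pairSum_div hμ (chainModel m₀ K₀) m₁ (ν := 1) (k := 0) le_rfl φ).and
      (ae_mem_support_step (chainModel m₀ K₀) m₁ K₁ 1))).exists
  obtain ⟨i, hia, hib⟩ : ∃ i, y i = a ∧ y (i + 1) = b := by
    by_contra! hne
    have h0 : ∀ n, pairSum φ 0 n y = 0 := fun n => Finset.sum_eq_zero fun i _ => by
      simp only [φ, zero_add]
      exact if_neg fun h => hne i h.1 h.2
    simp only [h0, zero_div] at hy2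
    exact hφ.ne (tendsto_nhds_unique tendsto_const_nhds hy2)
  have htop : ∀ n, i ≤ n → llSum (chainModel m₀ K₀) (chainModel m₁ K₁) 1 n y = ⊤ := by
    intro n hn
    refine sum_eq_top _ _ (fun j hj => ?_) (j := i + 1) (Finset.mem_Icc.2 (by omega)) ?_
    · obtain ⟨t, rfl⟩ : ∃ t, j = t + 1 := ⟨j - 1, by have := (Finset.mem_Icc.1 hj).1; omega⟩
      change ENNReal.log (K₁ (y t) (y (t + 1)) / K₀ (y t) (y (t + 1))) ≠ ⊥
      rw [Ne, ENNReal.log_eq_bot_iff, ENNReal.div_eq_zero_iff, not_or]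
      exact ⟨hy3 t (by omega), PMF.apply_ne_top _ _⟩
    · change ENNReal.log (K₁ (y i) (y (i + 1)) / K₀ (y i) (y (i + 1))) = ⊤
      rw [hia, hib, hb0, ENNReal.div_zero hb, ENNReal.log_top]
  have hlim : Tendsto (fun n : ℕ => llSum (chainModel m₀ K₀) (chainModel m₁ K₁) 1 n y / (n : EReal))
      atTop (𝓝 ⊤) := by
    refine tendsto_const_nhds.congr' ?_
    filter_upwards [eventually_ge_atTop i, eventually_gt_atTop 0] with n hn hn0
    rw [htop n hn, EReal.top_div_of_pos_ne_top (by exact_mod_cast hn0) (EReal.natCast_ne_top n)]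
  exact EReal.coe_ne_top I (tendsto_nhds_unique hy1 hlim)

end Chains

/-! ### Divergences of distributions on finite sets -/

lemma mul_log_div_eq_coe {p q : ℝ≥0∞} (hp : p ≠ ∞) (hq : q ≠ ∞) (h : p ≠ 0 → q ≠ 0) :
    (p : EReal) * ENNReal.log (p / q) = (p.toReal * Real.log (p.toReal / q.toReal) : ℝ) := by
  by_cases hp0 : p = 0
  · simp [hp0]
  · rw [log_div_eq_coe hp0 hp (h hp0) hq, EReal.coe_mul, ← ENNReal.ofReal_toReal hp,
      EReal.coe_ennreal_ofReal, max_eq_left ENNReal.toReal_nonneg, ENNReal.ofReal_toReal hp]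

lemma coe_ennreal_sum {ι : Type*} (s : Finset ι) (f : ι → ℝ≥0∞) :
    ((∑ i ∈ s, f i : ℝ≥0∞) : EReal) = ∑ i ∈ s, (f i : EReal) := by
  classical
  induction s using Finset.induction_on with
  | empty => simp
  | insert a s ha ih => rw [Finset.sum_insert ha, Finset.sum_insert ha, EReal.coe_ennreal_add, ih]

lemma coe_ennreal_eq_coe_toReal {a : ℝ≥0∞} (ha : a ≠ ∞) : (a : EReal) = (a.toReal : EReal) := by
  rw [← ENNReal.ofReal_toReal ha, EReal.coe_ennreal_ofReal, max_eq_left ENNReal.toReal_nonneg,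
    ENNReal.ofReal_toReal ha]

lemma mean_congr {S : Type*} [Fintype S] {p : PMF S} {f g : S → ℝ}
    (h : ∀ y, p y ≠ 0 → f y = g y) : mean p f = mean p g := by
  refine Finset.sum_congr rfl fun y _ => ?_
  by_cases hy : p y = 0
  · simp [hy]
  · rw [h y hy]

section Div

variable {S : Type*} [Fintype S] [MeasurableSpace S] [MeasurableSingletonClass S]

lemma absolutelyContinuous_iff {P Q : PMF S} :
    P.toMeasure ≪ Q.toMeasure ↔ ∀ y, P y ≠ 0 → Q y ≠ 0 := by
  constructor
  · intro h y hP hQ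
    have := h (s := {y}) (by rwa [Q.toMeasure_apply_singleton y (measurableSet_singleton y)])
    rw [P.toMeasure_apply_singleton y (measurableSet_singleton y)] at this
    exact hP this
  · intro h s hs
    have hm : MeasurableSet s := (Set.toFinite s).measurableSet
    rw [PMF.toMeasure_apply_eq_zero_iff _ hm, Set.disjoint_left] at hs ⊢
    exact fun y hy => hs ((Q.mem_support_iff y).2 (h y ((P.mem_support_iff y).1 hy)))

lemma llr_ae_eq {P Q : PMF S} (h : ∀ y, P y ≠ 0 → Q y ≠ 0) :
    llr P.toMeasure Q.toMeasure =ᵐ[P.toMeasure] fun y =>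
      Real.log ((P y).toReal / (Q y).toReal) := by
  have hw : P.toMeasure = Q.toMeasure.withDensity fun y => P y / Q y := by
    refine Measure.ext_of_singleton fun y => ?_
    rw [withDensity_apply _ (measurableSet_singleton y), lintegral_singleton,
      P.toMeasure_apply_singleton y (measurableSet_singleton y),
      Q.toMeasure_apply_singleton y (measurableSet_singleton y)]
    by_cases hy : Q y = 0
    · rw [hy, mul_zero]
      by_contra hP
      exact h y hP hy
    · rw [ENNReal.div_mul_cancel hy (Q.apply_ne_top y)]
  have h1 : P.toMeasure.rnDeriv Q.toMeasure =ᵐ[Q.toMeasure] fun y => P y / Q y := by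
    conv_lhs => rw [hw]
    exact Measure.rnDeriv_withDensity _ (measurable_of_finite _)
  filter_upwards [(absolutelyContinuous_iff.2 h).ae_le h1] with y hy
  rw [llr, hy, ENNReal.toReal_div]

lemma D_ne_top {P Q : PMF S} (h : ∀ y, P y ≠ 0 → Q y ≠ 0) : D P Q ≠ ∞ :=
  InformationTheory.klDiv_ne_top (absolutelyContinuous_iff.2 h) .of_finite

lemma toReal_D {P Q : PMF S} (h : ∀ y, P y ≠ 0 → Q y ≠ 0) :
    (D P Q).toReal = mean P fun y => Real.log ((P y).toReal / (Q y).toReal) := by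
  rw [D, InformationTheory.toReal_klDiv_of_measure_eq (absolutelyContinuous_iff.2 h) (by simp),
    integral_congr_ae (llr_ae_eq h), PMF.integral_eq_sum]
  rfl

lemma D_map_le {T : Type*} [MeasurableSpace T] (P Q : PMF S) (e : S → T) :
    D (P.map e) (Q.map e) ≤ D P Q := by
  have he : Measurable e := measurable_of_finite e
  rw [D, ← PMF.toMeasure_map (p := P) (hf := he), ← PMF.toMeasure_map (p := Q) (hf := he)]
  exact InformationTheory.klDiv_map_le _ _ he

/-- The binary divergence is the divergence of the laws of the indicator of `{a}`. -/
lemma d_le_D {P Q : PMF S} (h : ∀ y, P y ≠ 0 → Q y ≠ 0) (a : S) :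
    d (P a) (Q a) ≤ (D P Q : EReal) := by
  classical
  let e : S → Bool := fun y => decide (y = a)
  have htrue : ∀ R : PMF S, R.map e true = R a := by
    intro R
    rw [PMF.map_apply, tsum_eq_single a]
    · simp [e]
    · intro b hb
      simp [e, hb]
  have hfalse : ∀ R : PMF S, R.map e false = 1 - R a := by
    intro R
    have h1 := (R.map e).tsum_coe
    rw [tsum_fintype, Fintype.sum_bool, htrue] at h1
    rw [← h1, ENNReal.add_sub_cancel_left (R.apply_ne_top a)]
  have hac : ∀ t, P.map e t ≠ 0 → Q.map e t ≠ 0 := by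
    intro t ht
    rw [← PMF.mem_support_iff, PMF.mem_support_map_iff] at ht ⊢
    obtain ⟨y, hy, rfl⟩ := ht
    exact ⟨y, (Q.mem_support_iff y).2 (h y ((P.mem_support_iff y).1 hy)), rfl⟩
  have hd : d (P a) (Q a) = (D (P.map e) (Q.map e) : EReal) := by
    have h1 := mul_log_div_eq_coe ((P.map e).apply_ne_top true) ((Q.map e).apply_ne_top true)
      (hac true)
    have h2 := mul_log_div_eq_coe ((P.map e).apply_ne_top false) ((Q.map e).apply_ne_top false)
      (hac false)
    rw [coe_ennreal_eq_coe_toReal (D_ne_top hac), toReal_D hac, mean, Fintype.sum_bool,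
      EReal.coe_add, ← h1, ← h2, htrue, htrue, hfalse, hfalse, d]
  rw [hd, EReal.coe_ennreal_le_coe_ennreal_iff]
  exact D_map_le P Q e

variable {K₀ K₁ : S → PMF S} (μ : PMF S)

lemma pairMean_logRatio_eq (hK : ∀ a b, K₁ a b ≠ 0 → K₀ a b ≠ 0) :
    pairMean μ K₁ (logRatio K₀ K₁) = mean μ fun x => (D (K₁ x) (K₀ x)).toReal := by
  simp only [toReal_D (hK _)]
  rfl

lemma sum_mul_D_eq (hK : ∀ a b, K₁ a b ≠ 0 → K₀ a b ≠ 0) :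
    ((∑ x, μ x * D (K₁ x) (K₀ x) : ℝ≥0∞) : EReal) =
      (pairMean μ K₁ (logRatio K₀ K₁) : ℝ) := by
  have hne : ∀ x ∈ Finset.univ, μ x * D (K₁ x) (K₀ x) ≠ ∞ := fun x _ =>
    ENNReal.mul_ne_top (μ.apply_ne_top x) (D_ne_top (hK x))
  rw [coe_ennreal_eq_coe_toReal (ENNReal.sum_ne_top.2 hne), ENNReal.toReal_sum hne,
    pairMean_logRatio_eq μ hK]
  simp only [ENNReal.toReal_mul]
  rfl

lemma pairMean_logRatio_pos (hμ : ∀ x, μ x ≠ 0) (hK : ∀ a b, K₁ a b ≠ 0 → K₀ a b ≠ 0)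
    (hne : K₁ ≠ K₀) : 0 < pairMean μ K₁ (logRatio K₀ K₁) := by
  obtain ⟨x, hx⟩ := Function.ne_iff.1 hne
  rw [pairMean_logRatio_eq μ hK]
  refine Finset.sum_pos' (fun y _ => mul_nonneg ENNReal.toReal_nonneg ENNReal.toReal_nonneg)
    ⟨x, Finset.mem_univ x, mul_pos (toReal_pos_of_mem_support ((μ.mem_support_iff x).2 (hμ x))) ?_⟩
  refine ENNReal.toReal_pos (fun h => hx ?_) (D_ne_top (hK x))
  exact PMF.toMeasure_injective (InformationTheory.klDiv_eq_zero_iff.1 h)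

lemma sum_mul_iSup_d_le (hK : ∀ a b, K₁ a b ≠ 0 → K₀ a b ≠ 0) :
    ∑ x, (μ x : EReal) * (⨆ y, d (K₁ x y) (K₀ x y)) ≤
      ((∑ x, μ x * D (K₁ x) (K₀ x) : ℝ≥0∞) : EReal) := by
  rw [coe_ennreal_sum]
  refine Finset.sum_le_sum fun x _ => ?_
  rw [EReal.coe_ennreal_mul]
  exact mul_le_mul_of_nonneg_left (iSup_le fun y => d_le_D (hK x) y) (EReal.coe_ennreal_nonneg _)

end Div

section InfoRate

variable {S : Type*} [Fintype S] [MeasurableSpace S] [MeasurableSingletonClass S]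
  {m₀ m₁ : PMF S} {K₀ K₁ : S → PMF S} {μ : PMF S}

lemma infoRate_eq_pairMean (h : ∃ I, ConvergenceAssumption (chainModel m₀ K₀) (chainModel m₁ K₁) I)
    (hL : IsLiouville K₁) (hμ : IsStationary K₁ μ) (hK : ∀ a b, K₁ a b ≠ 0 → K₀ a b ≠ 0) :
    infoRate (chainModel m₀ K₀) (chainModel m₁ K₁) = (pairMean μ K₁ (logRatio K₀ K₁) : ℝ) := by
  rw [infoRate, dif_pos h, h.choose_spec.eq_pairMean hL hμ hK]

lemma infoRate_eq_top (hL : IsLiouville K₁) (hμ : IsStationary K₁ μ) {a b : S} (ha : μ a ≠ 0)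
    (hb : K₁ a b ≠ 0) (hb0 : K₀ a b = 0) :
    infoRate (chainModel m₀ K₀) (chainModel m₁ K₁) = ⊤ :=
  dif_neg fun ⟨I, hI⟩ => hL.not_convergenceAssumption hμ ha hb hb0 I hI

end InfoRate

/-! ### Observation of states and actions -/

section Full

variable {X U : Type*}

lemma stateAction_apply (μ : PMF X) (π : Policy X U) (x : X) (u : U) :
    stateAction μ π (x, u) = μ x * π x u := by
  classical
  rw [stateAction, PMF.bind_apply, tsum_eq_single x]
  · rw [PMF.map_apply, tsum_eq_single u]
    · simp
    · intro v hv
      simp [Ne.symm hv]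
  · intro y hy
    rw [PMF.map_apply]
    simp [Ne.symm hy]

/-- The transition probabilities of the pairs of state and action. -/
def MDP.fullKernel (M : MDP X U) (π : Policy X U) (s : X × U) : PMF (X × U) :=
  stateAction (M.P s.1 s.2) π

lemma IsStationary.stateAction {M : MDP X U} {π : Policy X U} {μ : PMF X}
    (hμ : IsStationary (M.induced π) μ) :
    IsStationary (M.fullKernel π) (stateAction μ π) := by
  have h : (PrivacyMDP.stateAction μ π).bind (M.fullKernel π) =
      PrivacyMDP.stateAction (μ.bind (M.induced π)) π := by
    simp only [PrivacyMDP.stateAction, MDP.induced, PMF.bind_bind, PMF.bind_map]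
    rfl
  rw [IsStationary, h, hμ]

variable [Fintype X] [Fintype U]

lemma mean_stateAction (μ : PMF X) (π : Policy X U) (f : X × U → ℝ) :
    mean (stateAction μ π) f = mean μ fun x => mean (π x) fun u => f (x, u) := by
  rw [stateAction, mean_bind]
  simp only [mean_map]

/-- A harmonic function of the pairs is determined by its average over the actions, which is
harmonic for the states. -/
lemma MDP.isLiouville_fullKernel {M : MDP X U} {π : Policy X U}
    (h : IsLiouville (M.induced π)) : IsLiouville (M.fullKernel π) := by
  intro f hf s t
  let H : X → ℝ := fun x => mean (π x) fun u => f (x, u)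
  have hfH : ∀ s, f s = mean (M.P s.1 s.2) H := fun s =>
    (hf s).trans (mean_stateAction _ _ _)
  have hH : ∀ x y, H x = H y := h H fun x => by
    rw [MDP.induced, mean_bind]
    exact congrArg (mean (π x)) (funext fun u => hfH (x, u))
  have hc : ∀ s, f s = H t.1 := fun s => by
    rw [hfH s, show H = fun _ => H t.1 from funext fun y => hH y t.1, mean_const]
  rw [hc s, hc t]

lemma log_mul_div_mul {a b c e : ℝ≥0∞} (ha : (a * b).toReal ≠ 0) (hc : (c * e).toReal ≠ 0) :
    Real.log ((a * b).toReal / (c * e).toReal) =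
      Real.log (a.toReal / c.toReal) + Real.log (b.toReal / e.toReal) := by
  rw [ENNReal.toReal_mul] at ha hc
  rw [ENNReal.toReal_mul, ENNReal.toReal_mul, mul_div_mul_comm, Real.log_mul
    (div_ne_zero (left_ne_zero_of_mul ha) (left_ne_zero_of_mul hc))
    (div_ne_zero (right_ne_zero_of_mul ha) (right_ne_zero_of_mul hc))]

/-- The information rate of states and actions is the sum of the divergences of the policies and of
the transition probabilities. -/
lemma pairMean_fullKernel_eq {M₀ M₁ : MDP X U} {π₀ π₁ : Policy X U}
    (hP : ∀ x u y, M₁.P x u y ≠ 0 → M₀.P x u y ≠ 0) (hπ : ∀ x u, π₁ x u ≠ 0 → π₀ x u ≠ 0)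
    {μ : PMF X} (hμ : IsStationary (M₁.induced π₁) μ) :
    pairMean (stateAction μ π₁) (M₁.fullKernel π₁)
        (logRatio (M₀.fullKernel π₀) (M₁.fullKernel π₁)) =
      mean μ fun x => mean (π₁ x) (fun u => Real.log ((π₁ x u).toReal / (π₀ x u).toReal)) +
        mean (π₁ x) (fun u => mean (M₁.P x u) fun y =>
          Real.log ((M₁.P x u y).toReal / (M₀.P x u y).toReal)) := by
  set E : X → ℝ := fun x => mean (π₁ x) fun u => Real.log ((π₁ x u).toReal / (π₀ x u).toReal)
  have hne : ∀ (M : MDP X U) (π : Policy X U) (s : X × U) y v,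
      M.fullKernel π s (y, v) ≠ 0 ↔ M.P s.1 s.2 y ≠ 0 ∧ π y v ≠ 0 := fun M π s y v => by
    rw [MDP.fullKernel, stateAction_apply, mul_ne_zero_iff]
  have h1 : ∀ s, mean (M₁.fullKernel π₁ s) (logRatio (M₀.fullKernel π₀) (M₁.fullKernel π₁) s) =
      mean (M₁.P s.1 s.2) (fun y =>
        Real.log ((M₁.P s.1 s.2 y).toReal / (M₀.P s.1 s.2 y).toReal)) +
      mean (M₁.P s.1 s.2) E := by
    intro s
    have h2 : mean (M₁.fullKernel π₁ s) (logRatio (M₀.fullKernel π₀) (M₁.fullKernel π₁) s) =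
        mean (M₁.fullKernel π₁ s) (fun t =>
          Real.log ((M₁.P s.1 s.2 t.1).toReal / (M₀.P s.1 s.2 t.1).toReal) +
            Real.log ((π₁ t.1 t.2).toReal / (π₀ t.1 t.2).toReal)) := by
      refine mean_congr ?_
      rintro ⟨y, v⟩ h
      have h' : M₀.fullKernel π₀ s (y, v) ≠ 0 := by
        rw [hne] at h ⊢
        exact ⟨hP _ _ _ h.1, hπ _ _ h.2⟩
      have h1 := ENNReal.toReal_ne_zero.2 ⟨h, PMF.apply_ne_top _ _⟩
      have h0 := ENNReal.toReal_ne_zero.2 ⟨h', PMF.apply_ne_top _ _⟩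
      simp only [logRatio, MDP.fullKernel, stateAction_apply] at h1 h0 ⊢
      exact log_mul_div_mul h1 h0
    rw [h2, MDP.fullKernel, mean_stateAction]
    simp only [mean_add, mean_const]
    rfl
  have h3 : mean μ (fun x => mean (π₁ x) fun u => mean (M₁.P x u) E) = mean μ E := by
    conv_rhs => rw [← hμ, mean_bind]
    simp only [MDP.induced, mean_bind]
  rw [pairMean, mean_stateAction]
  simp only [h1, mean_add, h3]
  ring

variable [MeasurableSpace X] [MeasurableSingletonClass X] [MeasurableSpace U]
  [MeasurableSingletonClass U]

/-- Data processing for one transition: the next state carries at most as much information as the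
action together with the next state. -/
lemma toReal_D_induced_le {M₀ M₁ : MDP X U} {π₀ π₁ : Policy X U}
    (hP : ∀ x u y, M₁.P x u y ≠ 0 → M₀.P x u y ≠ 0) (hπ : ∀ x u, π₁ x u ≠ 0 → π₀ x u ≠ 0) (x : X) :
    (D (M₁.induced π₁ x) (M₀.induced π₀ x)).toReal ≤
      mean (π₁ x) (fun u => Real.log ((π₁ x u).toReal / (π₀ x u).toReal)) +
        mean (π₁ x) (fun u => mean (M₁.P x u) fun y =>
          Real.log ((M₁.P x u y).toReal / (M₀.P x u y).toReal)) := by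
  let J : MDP X U → Policy X U → PMF (U × X) := fun M π => stateAction (π x) (M.P x)
  have hsnd : ∀ M π, (J M π).map Prod.snd = MDP.induced M π x := by
    intro M π
    simp only [J, stateAction, PMF.map_bind, PMF.map_comp, MDP.induced]
    exact congrArg _ (funext fun u => PMF.map_id _)
  have hne : ∀ M π u y, J M π (u, y) ≠ 0 ↔ π x u ≠ 0 ∧ M.P x u y ≠ 0 := fun M π u y => by
    rw [stateAction_apply, mul_ne_zero_iff]
  have hac : ∀ s, J M₁ π₁ s ≠ 0 → J M₀ π₀ s ≠ 0 := by
    rintro ⟨u, y⟩ h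
    rw [hne] at h ⊢
    exact ⟨hπ x u h.1, hP x u y h.2⟩
  have h1 : (D (M₁.induced π₁ x) (M₀.induced π₀ x)).toReal ≤ (D (J M₁ π₁) (J M₀ π₀)).toReal := by
    rw [← hsnd, ← hsnd]
    exact ENNReal.toReal_mono (D_ne_top hac) (D_map_le _ _ _)
  refine h1.trans_eq ?_
  have h2 : mean (J M₁ π₁) (fun s => Real.log ((J M₁ π₁ s).toReal / (J M₀ π₀ s).toReal)) =
      mean (J M₁ π₁) (fun s => Real.log ((π₁ x s.1).toReal / (π₀ x s.1).toReal) +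
        Real.log ((M₁.P x s.1 s.2).toReal / (M₀.P x s.1 s.2).toReal)) := by
    refine mean_congr ?_
    rintro ⟨u, y⟩ h
    have h1 := ENNReal.toReal_ne_zero.2 ⟨h, PMF.apply_ne_top _ _⟩
    have h0 := ENNReal.toReal_ne_zero.2 ⟨hac _ h, PMF.apply_ne_top _ _⟩
    simp only [J, stateAction_apply] at h1 h0 ⊢
    exact log_mul_div_mul h1 h0
  rw [toReal_D hac, h2, mean_stateAction, ← mean_add]
  simp only [mean_add, mean_const]

/-- Observing the actions in addition to the states does not decrease the information rate. -/
lemma infoRate_limited_le_full {M₀ M₁ : MDP X U} {π₀ π₁ : Policy X U}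
    (hP : ∀ x u y, M₁.P x u y ≠ 0 → M₀.P x u y ≠ 0)
    (hK : ∀ x y, M₁.induced π₁ x y ≠ 0 → M₀.induced π₀ x y ≠ 0)
    (hL : IsLiouville (M₁.induced π₁)) {μ : PMF X} (hμ : IsStationary (M₁.induced π₁) μ)
    (hpos : ∀ x, μ x ≠ 0) (m₀ m₁ : PMF (X × U)) :
    ((pairMean μ (M₁.induced π₁) (logRatio (M₀.induced π₀) (M₁.induced π₁)) : ℝ) : EReal) ≤
      infoRate (chainModel m₀ (M₀.fullKernel π₀)) (chainModel m₁ (M₁.fullKernel π₁)) := by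
  by_cases hπ : ∀ x u, π₁ x u ≠ 0 → π₀ x u ≠ 0
  · by_cases h : ∃ I, ConvergenceAssumption (chainModel m₀ (M₀.fullKernel π₀))
        (chainModel m₁ (M₁.fullKernel π₁)) I
    · have hac : ∀ s t, M₁.fullKernel π₁ s t ≠ 0 → M₀.fullKernel π₀ s t ≠ 0 := by
        rintro s ⟨y, v⟩
        simp only [MDP.fullKernel, stateAction_apply, mul_ne_zero_iff]
        exact fun h => ⟨hP _ _ _ h.1, hπ _ _ h.2⟩
      rw [infoRate_eq_pairMean h (MDP.isLiouville_fullKernel hL) hμ.stateAction hac,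
        EReal.coe_le_coe_iff, pairMean_fullKernel_eq hP hπ hμ, pairMean_logRatio_eq μ hK]
      exact mean_mono μ fun x => toReal_D_induced_le hP hπ x
    · rw [infoRate, dif_neg h]
      exact le_top
  · -- an action that only the new policy takes reveals the change
    push Not at hπ
    obtain ⟨x, u, hu, hu0⟩ := hπ
    have hx : x ∈ (μ.bind (M₁.induced π₁)).support := by
      rw [hμ]; exact (μ.mem_support_iff x).2 (hpos x)
    obtain ⟨x', hx', hxx'⟩ := (PMF.mem_support_bind_iff _ _ _).1 hx
    obtain ⟨u', hu', hxu'⟩ := (PMF.mem_support_bind_iff _ _ _).1 hxx'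
    rw [PMF.mem_support_iff] at hx' hu' hxu'
    rw [infoRate_eq_top (a := (x', u')) (b := (x, u)) (MDP.isLiouville_fullKernel hL)
      hμ.stateAction]
    · exact le_top
    · rw [stateAction_apply]; exact mul_ne_zero hx' hu'
    · rw [MDP.fullKernel, stateAction_apply]; exact mul_ne_zero hxu' hu
    · rw [MDP.fullKernel, stateAction_apply, hu0, mul_zero]

end Full

end PrivacyMDP

end

open PrivacyMDP in
theorem theorem3 {X U : Type*}
    [Fintype X] [Nonempty X] [MeasurableSpace X] [MeasurableSingletonClass X]
    [Fintype U] [Nonempty U] [MeasurableSpace U] [MeasurableSingletonClass U]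
    (M₀ M₁ : MDP X U) (hM₀ : M₀.IsErgodic) (hM₁ : M₁.IsErgodic)
    (hP : ∀ x u, (M₁.P x u).toMeasure ≪ (M₀.P x u).toMeasure)
    (π₀ π₁ : Policy X U) (μ₀ μ₁ : PMF X)
    (hμ₀ : IsStationary (M₀.induced π₀) μ₀) (hμ₁ : IsStationary (M₁.induced π₁) μ₁)
    -- the law of the first state when the change occurs before the first observation
    (ξ : PMF X) :
    -- (i)
    ((∀ x ∈ μ₁.support, (M₁.induced π₁ x).toMeasure ≪ (M₀.induced π₀ x).toMeasure) →
      M₁.induced π₁ ≠ M₀.induced π₀ →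
      (∃ I : ℝ, ConvergenceAssumption (M₀.limitedModel π₀ μ₀) (M₁.limitedModel π₁ ξ) I) ∧
      infoRate (M₀.limitedModel π₀ μ₀) (M₁.limitedModel π₁ ξ) =
        ((∑ x, μ₁ x * D (M₁.induced π₁ x) (M₀.induced π₀ x) : ℝ≥0∞) : EReal) ∧
      infoRate (M₀.limitedModel π₀ μ₀) (M₁.limitedModel π₁ ξ) ≤
        infoRate (M₀.fullModel π₀ μ₀) (M₁.fullModel π₁ ξ) ∧
      ∑ x, (μ₁ x : EReal) * (⨆ x' : X, d (M₁.induced π₁ x x') (M₀.induced π₀ x x')) ≤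
        infoRate (M₀.limitedModel π₀ μ₀) (M₁.limitedModel π₁ ξ)) ∧
    -- (ii)
    ((∃ x ∈ μ₁.support, ¬ (M₁.induced π₁ x).toMeasure ≪ (M₀.induced π₀ x).toMeasure) →
      infoRate (M₀.limitedModel π₀ μ₀) (M₁.limitedModel π₁ ξ) = ⊤) := by
  have hK₁ : IsIrreducibleChain (M₁.induced π₁) := hM₁ π₁
  have hL : IsLiouville (M₁.induced π₁) := hK₁.isLiouville
  have hpos₀ : ∀ x, μ₀ x ≠ 0 := fun x => (μ₀.mem_support_iff x).1 (hμ₀.mem_support (hM₀ π₀) x)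
  have hpos₁ : ∀ x, μ₁ x ≠ 0 := fun x => (μ₁.mem_support_iff x).1 (hμ₁.mem_support hK₁ x)
  refine ⟨fun hac hne => ?_, ?_⟩
  · have hK : ∀ x y, M₁.induced π₁ x y ≠ 0 → M₀.induced π₀ x y ≠ 0 := fun x =>
      absolutelyContinuous_iff.1 (hac x ((μ₁.mem_support_iff x).2 (hpos₁ x)))
    have hex : ∃ I : ℝ, ConvergenceAssumption (M₀.limitedModel π₀ μ₀) (M₁.limitedModel π₁ ξ) I :=
      ⟨_, hL.convergenceAssumption hμ₁ (fun a _ => hpos₀ a) hK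
        (pairMean_logRatio_pos μ₁ hpos₁ hK hne)⟩
    have hrate : infoRate (M₀.limitedModel π₀ μ₀) (M₁.limitedModel π₁ ξ) =
        (pairMean μ₁ (M₁.induced π₁) (logRatio (M₀.induced π₀) (M₁.induced π₁)) : ℝ) :=
      infoRate_eq_pairMean hex hL hμ₁ hK
    refine ⟨hex, ?_, ?_, ?_⟩
    · rw [hrate, sum_mul_D_eq μ₁ hK]
    · rw [hrate]
      exact infoRate_limited_le_full (fun x u => absolutelyContinuous_iff.1 (hP x u)) hK hL hμ₁
        hpos₁ _ _
    · rw [hrate, ← sum_mul_D_eq μ₁ hK]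
      exact sum_mul_iSup_d_le μ₁ hK
  · rintro ⟨x, -, hx⟩
    rw [absolutelyContinuous_iff] at hx
    push Not at hx
    obtain ⟨y, hy, hy0⟩ := hx
    exact infoRate_eq_top hL hμ₁ (hpos₁ x) hy hy0
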